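/- Let $I=[0,1]$ (or the circle $\mathbb R/\mathbb Z$, read as $[0,1)$) and let $f:I\to I$ be a $C^2$ map with finitely many critical points, all non-flat (near each critical point $c$, $|f(x)-f(c)|$ is comparable to $|x-c|^{\ell}$ for some $\ell>0$), such that all periodic points are hyperbolically repelling and every iterate $f^n$, $n\ge 1$, has a dense orbit. Let $\mathcal P_1$ be the family of maximal open intervals in $(0,1)$ on which $f$ (for the circle: $f$ taken mod $1$) is continuous and strictly monotone, $\mathcal P_n=\bigvee_{i<n}f^{-i}\mathcal P_1$ (non-empty elements), $\mathcal P_0=\{(0,1)\}$. For $\varphi:I\to\mathbb R$ put $\varphi_n=\sum_{k<n}\varphi\circ f^k$, $\beta_n(\varphi)=\sup_{C\in\mathcal P_n}\sup_{x,y\in C}|\varphi_n(x)-\varphi_n(y)|$ and $$P_{top}(\varphi)=\lim_n \tfrac1n\log\sum_{C\in\mathcal P_n}\sup_{C}e^{\varphi_n}.$$ The Hofbauer tower $\hat I$ is the set of pairs $(x,D)$ with $x\in D\in\mathcal D$, where $\mathcal D=\{f^n(C): n\ge 0,\ C\in\mathcal P_n\}$. If $C\supseteq C'$ are cylinders in $\mathcal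 P_n$ and $\mathcal P_{n+1}$, $D=f^n(C)$ and $D'=f^{n+1}(C')$, write $D\to D'$ and put $\hat f(x,D)=(f(x),D')$ for $x\in f^n(C')$. Put $\hat\varphi(x,D)=\varphi(x)$, $\hat\varphi_n=\sum_{k<n}\hat\varphi\circ\hat f^k$. The $n$-cylinders of the tower, $n\ge 0$, are the non-empty sets $(D\cap C)\times\{D\}$ with $D\in\mathcal D$, $C\in\mathcal P_n$; their family is $\hat{\mathcal P}_n$. The transitive part $\hat I_{trans}$ of the tower is the part over a non-empty closed primitive subgraph $\mathcal E$ of $(\mathcal D,\to)$, i.e. no arrow leaves $\mathcal E$, and any two vertices of $\mathcal E$ are joined by an $n$-path for all sufficiently large $n$. For a cylinder $\hat C$ in $\hat I_{trans}$ let $$P_G(\hat\varphi,\hat C)=\limsup_n\tfrac1n\log\sum_{\hat x\in\hat C,\ \hat f^n\hat x=\hat x}e^{\hat\varphi_n(\hat x)},\qquad P_{top}(\hat\varphi,\hat C)=\lim_n\tfrac1n\log\sum_{\hat J\in\hat{\mathcal P}_n,\ \hat J\subseteq\hat C}\ \sup_{\hat J}e^{\hat\varphi_n}.$$ **Claim.**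 Suppose that $\varphi$ is bounded, $\beta_n(\varphi)=o(n)$ and $\sup\varphi-\inf\varphi<h_{top}(f)$. Then the limits $P_{top}(\varphi)$ and $P_{top}(\hat\varphi,\hat C)$ exist and are finite for every cylinder $\hat C$ (of any order) in $\hat I_{trans}$, $P_{top}(\hat\varphi,\hat C)$ does not depend on $\hat C$ (call it $P_{top}(\hat\varphi)$) and equals $P_{top}(\varphi)$, and $$P_{top}(\hat\varphi)=P_G(\hat\varphi,\hat C)\qquad\text{for every cylinder }\hat C\text{ in }\hat I_{trans}.$$ -/

import Mathlib

open Set Filter Topology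

noncomputable section

namespace HofbauerTower

/-! ### The class of maps -/

/-- `f` maps `[0,1]` into itself, is `C²` with finitely many critical points, all of them non-flat,
all its periodic points are hyperbolically repelling, and every iterate `f^n`, `n ≥ 1`,
has a dense orbit.  Only the values of `f` on `[0,1]` matter. -/
structure IsIntervalMapH (f : ℝ → ℝ) : Prop where
  mapsTo : MapsTo f (Icc 0 1) (Icc 0 1)
  contDiffOn : ContDiffOn ℝ 2 f (Icc 0 1)
  finite_crit : {c ∈ Icc (0 : ℝ) 1 | derivWithin f (Icc 0 1) c = 0}.Finite
  nonflat : ∀ c ∈ Icc (0 : ℝ) 1, derivWithin f (Icc 0 1) c = 0 →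
    ∃ l > (0 : ℝ), ∃ K ≥ (1 : ℝ), ∀ᶠ x in 𝓝[Icc 0 1] c,
      K⁻¹ * |x - c| ^ l ≤ |f x - f c| ∧ |f x - f c| ≤ K * |x - c| ^ l
  repelling : ∀ x ∈ Icc (0 : ℝ) 1, ∀ n ≥ 1, f^[n] x = x → 1 < |derivWithin f^[n] (Icc 0 1) x|
  mixing : ∀ n ≥ 1, ∃ x ∈ Icc (0 : ℝ) 1, Icc 0 1 ⊆ closure (range fun k : ℕ => (f^[n])^[k] x)

/-- The same for a map `g` of the circle `ℝ / ℤ`, expressed through a lift `F : ℝ → ℝ` of `g`. -/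
structure IsCircleMapH (g : UnitAddCircle → UnitAddCircle) : Prop where
  smooth : ∃ F : ℝ → ℝ, ContDiff ℝ 2 F ∧ (∀ x : ℝ, g (x : UnitAddCircle) = (F x : UnitAddCircle)) ∧
    {c ∈ Ico (0 : ℝ) 1 | deriv F c = 0}.Finite ∧
    (∀ c : ℝ, deriv F c = 0 → ∃ l > (0 : ℝ), ∃ K ≥ (1 : ℝ), ∀ᶠ x in 𝓝 c,
      K⁻¹ * |x - c| ^ l ≤ |F x - F c| ∧ |F x - F c| ≤ K * |x - c| ^ l) ∧
    (∀ x : ℝ, ∀ n ≥ 1, g^[n] (x : UnitAddCircle) = (x : UnitAddCircle) → 1 < |deriv F^[n] x|)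
  mixing : ∀ n ≥ 1, ∃ x, Dense (range fun k : ℕ => (g^[n])^[k] x)

/-- A circle map read as a map of `[0,1)`: `x ↦ g x (mod 1)`. -/
def circleRep (g : UnitAddCircle → UnitAddCircle) (x : ℝ) : ℝ :=
  (AddCircle.equivIco (1 : ℝ) 0 (g (x : UnitAddCircle)) : ℝ)

/-- The class of smooth, topologically mixing maps of the interval or the circle. -/
inductive MapH : Type where
  | interval (f : ℝ → ℝ) (hf : IsIntervalMapH f) : MapH
  | circle (g : UnitAddCircle → UnitAddCircle) (hg : IsCircleMapH g) : MapH

/-- The phase space `I`; the circle is read as `[0,1)`. -/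
def MapH.space : MapH → Set ℝ
  | .interval _ _ => Icc 0 1
  | .circle _ _ => Ico 0 1

/-- The map `f : I → I` (its values outside `I` are irrelevant). -/
def MapH.map : MapH → ℝ → ℝ
  | .interval f _ => f
  | .circle g _ => circleRep g

/-- Topological entropy of the (continuous) map on the interval, respectively the circle. -/
def MapH.htop : MapH → EReal
  | .interval f _ => Dynamics.coverEntropy f (Icc 0 1)
  | .circle g _ => Dynamics.coverEntropy g univ

/-! ### Branch partition and cylinders

Intervals of the partitions are taken open, so that `𝒫 n` partitions `I` up to a finite set. -/

/-- An open interval `J ⊆ (0,1)` on which `f` is continuous and strictly monotone. -/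
structure IsMonotoneInterval (f : ℝ → ℝ) (J : Set ℝ) : Prop where
  isOpen : IsOpen J
  nonempty : J.Nonempty
  ordConnected : J.OrdConnected
  subset : J ⊆ Ioo 0 1
  continuousOn : ContinuousOn f J
  strict : StrictMonoOn f J ∨ StrictAntiOn f J

/-- The branch partition `𝒫₁`: the maximal intervals of monotonicity of `f`. -/
def branches (f : ℝ → ℝ) : Set (Set ℝ) := {J | Maximal (IsMonotoneInterval f) J}

/-- `𝒫ₙ = ⋁_{i<n} f⁻ⁱ 𝒫₁` (nonempty elements only); `𝒫₀` consists of the single set `(0,1)`. -/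
def cylinders (f : ℝ → ℝ) (n : ℕ) : Set (Set ℝ) :=
  {C | C.Nonempty ∧ ∃ A : ℕ → Set ℝ, (∀ i < n, A i ∈ branches f) ∧
    C = {x ∈ Ioo (0 : ℝ) 1 | ∀ i < n, f^[i] x ∈ A i}}

/-- `βₙ(φ) = sup_{C ∈ 𝒫ₙ} sup_{x,y ∈ C} |φₙ(x) - φₙ(y)|`. -/
def beta (f φ : ℝ → ℝ) (n : ℕ) : ℝ :=
  sSup {r | ∃ C ∈ cylinders f n, ∃ x ∈ C, ∃ y ∈ C,
    r = |birkhoffSum f φ n x - birkhoffSum f φ n y|}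

/-- `∑_{C ∈ 𝒫ₙ} sup_{x ∈ C} exp φₙ(x)`, whose exponential growth rate is `P_top(φ)`. -/
def topSum (f φ : ℝ → ℝ) (n : ℕ) : ENNReal :=
  ∑' C : cylinders f n, ⨆ x ∈ (C : Set ℝ), ENNReal.ofReal (Real.exp (birkhoffSum f φ n x))

/-! ### The Hofbauer tower -/

/-- The domains `D = fⁿ(C)`, `C ∈ 𝒫ₙ`, `n ≥ 0`. -/
def domains (f : ℝ → ℝ) : Set (Set ℝ) := {D | ∃ n, ∃ C ∈ cylinders f n, D = f^[n] '' C}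

/-- The arrow `D → D'`: there are cylinders `C ⊇ C'` of order `n` and `n + 1`
with `D = fⁿ(C)` and `D' = fⁿ⁺¹(C')`. -/
def Arrow (f : ℝ → ℝ) (D D' : Set ℝ) : Prop :=
  ∃ n, ∃ C ∈ cylinders f n, ∃ C' ∈ cylinders f (n + 1),
    C' ⊆ C ∧ D = f^[n] '' C ∧ D' = f^[n + 1] '' C'

/-- There is an `n`-path `D → ⋯ → D'`. -/
def HasPath (f : ℝ → ℝ) (n : ℕ) (D D' : Set ℝ) : Prop :=
  ∃ p : ℕ → Set ℝ, p 0 = D ∧ p n = D' ∧ ∀ k < n, Arrow f (p k) (p (k + 1))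

/-- Points of the tower are pairs `(x, D)` with `D` a domain and `x ∈ D`.  The map is
`(x, D) ↦ (f x, f (D ∩ A))`, where `A` is the branch containing `x`.  If `x` lies in no branch,
the second entry becomes `∅`, which is not a domain: the point leaves the tower forever. -/
def hatMap (f : ℝ → ℝ) (p : ℝ × Set ℝ) : ℝ × Set ℝ :=
  (f p.1, f '' {y ∈ p.2 | ∃ A ∈ branches f, p.1 ∈ A ∧ y ∈ A})

/-- The lifted potential `φ̂ = φ ∘ π`. -/
def hatPot (φ : ℝ → ℝ) (p : ℝ × Set ℝ) : ℝ := φ p.1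

/-- The elements of `π⁻¹(𝒫ₙ) ∨ 𝒟` that lie in the domains belonging to `E`:
the `n`-cylinders of the part of the tower over `E`. -/
def hatCylinders (f : ℝ → ℝ) (E : Set (Set ℝ)) (n : ℕ) : Set (Set (ℝ × Set ℝ)) :=
  {J | ∃ D ∈ E, ∃ C ∈ cylinders f n, (D ∩ C).Nonempty ∧ J = (D ∩ C) ×ˢ {D}}

/-- `E` is a closed primitive subgraph of the graph of domains: no arrow leaves `E`, and any two
vertices of `E` are joined by an `n`-path for all large `n`.  (The transitive part of the tower
is such a subgraph.) -/
structure IsTransitivePart (f : ℝ → ℝ) (E : Set (Set ℝ)) : Prop where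
  subset : E ⊆ domains f
  nonempty : E.Nonempty
  closed : ∀ D ∈ E, ∀ D', Arrow f D D' → D' ∈ E
  primitive : ∀ D ∈ E, ∀ D' ∈ E, ∀ᶠ n in atTop, HasPath f n D D'

/-- `∑ sup_{Ĵ} exp φ̂ₙ` over the `n`-cylinders `Ĵ` of the tower contained in `Ĉ`. -/
def hatTopSum (f φ : ℝ → ℝ) (Chat : Set (ℝ × Set ℝ)) (n : ℕ) : ENNReal :=
  ∑' J : {J // J ∈ hatCylinders f (domains f) n ∧ J ⊆ Chat},
    ⨆ p ∈ (J : Set (ℝ × Set ℝ)),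
      ENNReal.ofReal (Real.exp (birkhoffSum (hatMap f) (hatPot φ) n p))

/-- `Zₙ(φ̂, Ĉ) = ∑_{f̂ⁿ x̂ = x̂} exp (φ̂ₙ x̂) 1_Ĉ(x̂)`. -/
def hatZ (f φ : ℝ → ℝ) (Chat : Set (ℝ × Set ℝ)) (n : ℕ) : ENNReal :=
  ∑' p : {p // p ∈ Chat ∧ (hatMap f)^[n] p = p},
    ENNReal.ofReal (Real.exp (birkhoffSum (hatMap f) (hatPot φ) n p))

/-- Gurevich pressure `P_G(φ̂, Ĉ) = limsup (1/n) log Zₙ(φ̂, Ĉ)`, with `log 0 = -∞`. -/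
def hatGurevich (f φ : ℝ → ℝ) (Chat : Set (ℝ × Set ℝ)) : EReal :=
  limsup (fun n : ℕ => ENNReal.log (hatZ f φ Chat n) / n) atTop

/-! ### The tower map is the one given by nested cylinders -/

theorem IsMonotoneInterval.union {f : ℝ → ℝ} {A B : Set ℝ} (hA : IsMonotoneInterval f A)
    (hB : IsMonotoneInterval f B) {x : ℝ} (hxA : x ∈ A) (hxB : x ∈ B) :
    IsMonotoneInterval f (A ∪ B) := by
  have key : ∀ {A B : Set ℝ}, A.OrdConnected → B.OrdConnected → x ∈ A → x ∈ B → ∀ u ∈ A, ∀ v ∈ B,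
      u < v → (u ∈ A ∧ v ∈ A) ∨ (u ∈ B ∧ v ∈ B) ∨ (u < x ∧ x < v) := by
    intro A B oA oB hxA hxB u hu v hv huv
    rcases le_or_gt x u with h | h
    · exact Or.inr (Or.inl ⟨oB.out hxB hv ⟨h, huv.le⟩, hv⟩)
    rcases le_or_gt v x with h' | h'
    · exact Or.inl ⟨hu, oA.out hu hxA ⟨huv.le, h'⟩⟩
    · exact Or.inr (Or.inr ⟨h, h'⟩)
  have hopp : ∃ y ∈ A ∩ B, x < y := by
    have h1 : A ∩ B ∈ 𝓝 x := (hA.isOpen.inter hB.isOpen).mem_nhds ⟨hxA, hxB⟩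
    have h2 : ∀ᶠ y in 𝓝[>] x, y ∈ A ∩ B := mem_nhdsWithin_of_mem_nhds h1
    obtain ⟨y, hy, hxy⟩ := (h2.and self_mem_nhdsWithin).exists
    exact ⟨y, hy, hxy⟩
  obtain ⟨y, ⟨hyA, hyB⟩, hxy⟩ := hopp
  refine ⟨hA.isOpen.union hB.isOpen, hA.nonempty.inl, ?_, union_subset hA.subset hB.subset,
    hA.continuousOn.union_of_isOpen hB.continuousOn hA.isOpen hB.isOpen, ?_⟩
  · exact (hA.ordConnected.isPreconnected.union x hxA hxB
      hB.ordConnected.isPreconnected).ordConnected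
  · rcases hA.strict with mA | mA <;> rcases hB.strict with mB | mB
    · left
      rintro u (hu | hu) v (hv | hv) huv
      · exact mA hu hv huv
      · rcases key hA.ordConnected hB.ordConnected hxA hxB u hu v hv huv with h | h | h
        · exact mA h.1 h.2 huv
        · exact mB h.1 h.2 huv
        · exact (mA hu hxA h.1).trans (mB hxB hv h.2)
      · rcases key hB.ordConnected hA.ordConnected hxB hxA u hu v hv huv with h | h | h
        · exact mB h.1 h.2 huv
        · exact mA h.1 h.2 huv
        · exact (mB hu hxB h.1).trans (mA hxA hv h.2)
      · exact mB hu hv huv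
    · exact absurd (mA hxA hyA hxy) (mB hxB hyB hxy).not_gt
    · exact absurd (mB hxB hyB hxy) (mA hxA hyA hxy).not_gt
    · right
      rintro u (hu | hu) v (hv | hv) huv
      · exact mA hu hv huv
      · rcases key hA.ordConnected hB.ordConnected hxA hxB u hu v hv huv with h | h | h
        · exact mA h.1 h.2 huv
        · exact mB h.1 h.2 huv
        · exact (mB hxB hv h.2).trans (mA hu hxA h.1)
      · rcases key hB.ordConnected hA.ordConnected hxB hxA u hu v hv huv with h | h | h
        · exact mB h.1 h.2 huv
        · exact mA h.1 h.2 huv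
        · exact (mA hxA hv h.2).trans (mB hu hxB h.1)
      · exact mB hu hv huv

/-- Distinct branches are disjoint. -/
theorem branches_eq {f : ℝ → ℝ} {A B : Set ℝ} (hA : A ∈ branches f) (hB : B ∈ branches f)
    {x : ℝ} (hxA : x ∈ A) (hxB : x ∈ B) : A = B := by
  have h := hA.prop.union hB.prop hxA hxB
  rw [hA.eq_of_le h subset_union_left, ← hB.eq_of_le h subset_union_right]

/-- If `C ⊇ C'` are cylinders of order `n` and `n + 1` and `x ∈ fⁿ(C')`, then the tower map sends
`(x, fⁿ(C))` to `(f x, fⁿ⁺¹(C'))`. -/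
theorem hatMap_eq {f : ℝ → ℝ} {n : ℕ} {C C' : Set ℝ} (hC : C ∈ cylinders f n)
    (hC' : C' ∈ cylinders f (n + 1)) (hCC : C' ⊆ C) {x : ℝ} (hx : x ∈ f^[n] '' C') :
    hatMap f (x, f^[n] '' C) = (f x, f^[n + 1] '' C') := by
  obtain ⟨-, B, hB, rfl⟩ := hC
  obtain ⟨-, A, hA, rfl⟩ := hC'
  obtain ⟨z, ⟨hz, hzA⟩, rfl⟩ := hx
  have hAB : ∀ i < n, A i = B i := fun i hi =>
    branches_eq (hA i (by omega)) (hB i hi) (hzA i (by omega)) ((hCC ⟨hz, hzA⟩).2 i hi)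
  simp only [hatMap, Prod.mk.injEq, true_and]
  ext w
  constructor
  · rintro ⟨y, ⟨⟨u, ⟨hu, huB⟩, rfl⟩, A', hA', hzA', huA'⟩, rfl⟩
    have : A' = A n := branches_eq hA' (hA n (by omega)) hzA' (hzA n (by omega))
    subst this
    refine ⟨u, ⟨hu, fun i hi => ?_⟩, Function.iterate_succ_apply' f n u⟩
    rcases Nat.lt_succ_iff_lt_or_eq.mp hi with h | rfl
    · rw [hAB i h]; exact huB i h
    · exact huA'
  · rintro ⟨u, hu, rfl⟩
    exact ⟨f^[n] u, ⟨⟨u, hCC hu, rfl⟩, A n, hA n (by omega), hzA n (by omega), hu.2 n (by omega)⟩,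
      (Function.iterate_succ_apply' f n u).symm⟩

end HofbauerTower

end

noncomputable section

namespace HofbauerTower

/-! Write `a = inf φ` and `b = sup φ`. The partition sums `topSum` are submultiplicative, so by
Fekete's lemma they have an exponential rate `P`. It remains to squeeze the sums of the tower
between multiples of `topSum` with the same rate.

Upper bounds: the `n`-cylinders of one level of the tower inject into the `n`-cylinders of `f`. A
cylinder holds at most one fixed point of `fⁿ`, since two of them would bound an invariant interval,
which dense orbits exclude (`fixed_unique`). Hence `hatTopSum` and `hatZ` are at most `topSum`.

Lower bounds: a vertex `D` of a primitive subgraph lies on a loop, so `D ⊆ fᵏ(D)`, and topological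
exactness makes some image of `D` cover `(0,1)`. Every cylinder is then visited from `D` after a
fixed time, at the price of a constant and of `exp βₙ` (`le_meetSum`). This settles `P_top`.

For periodic points, the paths starting in `D` must be closed up, although the graph may be
infinite. If `fⁿ(D ∩ C)` is an interval, all but at most two of the `R`-cylinders meeting it lie
inside it and lead to the finite family of domains `f^R(C')` (`meetSum_add_le`). The other paths
gain at most `2 exp(Rb)` in `R` steps, which is too slow when `b < P` and `R` is large. So, for
infinitely many times, at least half of the mass ends in this finite family
(`exists_frequently_meetSum_le`). By primitivity one time `l` brings all its members in the subgraph
back to `D`. Starting from a cylinder compactly inside `D`, each closed path contains a periodic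
point by the intermediate value theorem (`le_hatZ`).

The inequality `b < P` is where the entropy enters: the number of `n`-cylinders times `exp(na)` is
at most `topSum`, and the entropy is at most the growth rate of that number (`coverEntropy_le`).
Exactness comes from dense orbits and repelling periodic points (`exists_iterate_cover`); a circle
map is reduced to an interval map through its lift (`IsCircleMapH.exists_covers`). -/

/-! ### Monotone intervals and branches -/

/-- A continuous strictly monotone image of an open interval is open. -/
theorem isOpen_image_of_strict {h : ℝ → ℝ} {U : Set ℝ} (hU : IsOpen U) (hoc : U.OrdConnected)
    (hc : ContinuousOn h U) (hs : StrictMonoOn h U ∨ StrictAntiOn h U) : IsOpen (h '' U) := by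
  have himg : (h '' U).OrdConnected := (hoc.isPreconnected.image h hc).ordConnected
  rw [isOpen_iff_mem_nhds]
  rintro _ ⟨x, hx, rfl⟩
  obtain ⟨ε, hε, hb⟩ := Metric.isOpen_iff.1 hU x hx
  have h1 : x - ε / 2 ∈ U := hb (by simp [abs_of_pos hε]; linarith)
  have h2 : x + ε / 2 ∈ U := hb (by simp [abs_of_pos hε]; linarith)
  rcases hs with hs | hs
  · exact mem_of_superset (Icc_mem_nhds (hs h1 hx (by linarith)) (hs hx h2 (by linarith)))
      (himg.out ⟨_, h1, rfl⟩ ⟨_, h2, rfl⟩)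
  · exact mem_of_superset (Icc_mem_nhds (hs hx h2 (by linarith)) (hs h1 hx (by linarith)))
      (himg.out ⟨_, h2, rfl⟩ ⟨_, h1, rfl⟩)

/-- An open set of reals around `x` contains a point to the right of `x`. -/
theorem exists_gt_mem_of_isOpen {U : Set ℝ} (hU : IsOpen U) {x : ℝ} (hx : x ∈ U) :
    ∃ y ∈ U, x < y := by
  have h2 : ∀ᶠ y in 𝓝[>] x, y ∈ U := mem_nhdsWithin_of_mem_nhds (hU.mem_nhds hx)
  obtain ⟨y, hy, hxy⟩ := (h2.and self_mem_nhdsWithin).exists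
  exact ⟨y, hy, hxy⟩

/-- Every interval of monotonicity is contained in a branch. -/
theorem IsMonotoneInterval.exists_branch {f : ℝ → ℝ} {J : Set ℝ} (hJ : IsMonotoneInterval f J) :
    ∃ A ∈ branches f, J ⊆ A := by
  obtain ⟨x, hx⟩ := hJ.nonempty
  obtain ⟨y, hy, hxy⟩ := exists_gt_mem_of_isOpen hJ.isOpen hx
  -- The branch is the union of all monotone intervals through `x`. The pair `x < y` in `J` fixes
  -- the common orientation of those that contain `J`.
  set 𝒥 : Set (Set ℝ) := {K | IsMonotoneInterval f K ∧ x ∈ K} with h𝒥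
  have key : ∀ u ∈ ⋃₀ 𝒥, ∀ v ∈ ⋃₀ 𝒥, ∃ K ∈ 𝒥, u ∈ K ∧ v ∈ K ∧ J ⊆ K := by
    rintro u ⟨K, hK, hu⟩ v ⟨L, hL, hv⟩
    exact ⟨K ∪ L ∪ J, ⟨(hK.1.union hL.1 hK.2 hL.2).union hJ (Or.inl hK.2) hx, Or.inr hx⟩,
      Or.inl (Or.inl hu), Or.inl (Or.inr hv), subset_union_right⟩
  have hsub : J ⊆ ⋃₀ 𝒥 := subset_sUnion_of_mem ⟨hJ, hx⟩
  have hmon : IsMonotoneInterval f (⋃₀ 𝒥) := by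
    refine ⟨isOpen_sUnion fun K hK => hK.1.isOpen, ⟨x, hsub hx⟩, ⟨fun u hu v hv z hz => ?_⟩,
      sUnion_subset fun K hK => hK.1.subset, ?_, ?_⟩
    · obtain ⟨K, hK, huK, hvK, -⟩ := key u hu v hv
      exact ⟨K, hK, hK.1.ordConnected.out huK hvK hz⟩
    · rintro u ⟨K, hK, hu⟩
      exact (hK.1.continuousOn.continuousAt (hK.1.isOpen.mem_nhds hu)).continuousWithinAt
    · rcases hJ.strict with hs | hs
      · left
        intro u hu v hv huv
        obtain ⟨K, hK, huK, hvK, hJK⟩ := key u hu v hv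
        rcases hK.1.strict with h | h
        · exact h huK hvK huv
        · exact absurd (hs hx hy hxy) (h (hJK hx) (hJK hy) hxy).not_gt
      · right
        intro u hu v hv huv
        obtain ⟨K, hK, huK, hvK, hJK⟩ := key u hu v hv
        rcases hK.1.strict with h | h
        · exact absurd (hs hx hy hxy) (h (hJK hx) (hJK hy) hxy).not_gt
        · exact h huK hvK huv
  refine ⟨_, ⟨hmon, fun K hK hle => ?_⟩, hsub⟩
  exact subset_sUnion_of_mem ⟨hK, hle (hsub hx)⟩

/-- If the branches cover all but finitely many points, there are finitely many of them. -/
theorem branches_finite_of_exceptional {f : ℝ → ℝ} (h : (Icc (0 : ℝ) 1 \ ⋃₀ branches f).Finite) :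
    (branches f).Finite := by
  have bdd : ∀ {J}, J ∈ branches f → BddAbove J := fun hJ =>
    ⟨1, fun x hx => (hJ.prop.subset hx).2.le⟩
  have lts : ∀ {J}, J ∈ branches f → ∀ x ∈ J, x < sSup J := by
    intro J hJ x hx
    obtain ⟨y, hy, hxy⟩ := exists_gt_mem_of_isOpen hJ.prop.isOpen hx
    exact hxy.trans_le (le_csSup (bdd hJ) hy)
  have near : ∀ {J}, J ∈ branches f → ∀ r < sSup J,
      ∃ s < sSup J, r ≤ s ∧ ∀ y, s ≤ y → y < sSup J → y ∈ J := by
    intro J hJ r hr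
    obtain ⟨s, hs, hrs⟩ := exists_lt_of_lt_csSup hJ.prop.nonempty hr
    refine ⟨s, lts hJ s hs, hrs.le, fun y hy hyJ => ?_⟩
    obtain ⟨t, ht, hyt⟩ := exists_lt_of_lt_csSup hJ.prop.nonempty hyJ
    exact hJ.prop.ordConnected.out hs ht ⟨hy, hyt.le⟩
  -- The supremum of a branch lies in no branch, and disjoint branches have different suprema.
  refine Set.Finite.of_finite_image (f := sSup) (h.subset ?_) ?_
  · rintro _ ⟨J, hJ, rfl⟩
    obtain ⟨x, hx⟩ := hJ.prop.nonempty
    refine ⟨⟨(hJ.prop.subset hx).1.le.trans (le_csSup (bdd hJ) hx),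
      csSup_le hJ.prop.nonempty fun y hy => (hJ.prop.subset hy).2.le⟩, ?_⟩
    rintro ⟨K, hK, hmem⟩
    obtain ⟨ε, hε, hb⟩ := Metric.isOpen_iff.1 hK.prop.isOpen _ hmem
    obtain ⟨s, hs, hrs, hsJ⟩ := near hJ (sSup J - ε / 2) (by linarith)
    have hsK : s ∈ K := hb (by rw [Metric.mem_ball, Real.dist_eq, abs_lt]; constructor <;> linarith)
    have := branches_eq hJ hK (hsJ s le_rfl hs) hsK
    subst this
    exact lt_irrefl _ (lts hJ _ hmem)
  · intro J hJ K hK hJK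
    obtain ⟨s, hs, -, hsJ⟩ := near hJ (sSup J - 1) (by linarith)
    obtain ⟨t, ht, hst, htK⟩ := near hK s (by rw [← hJK]; exact hs)
    exact branches_eq hJ hK (hsJ t hst (by rw [hJK]; exact ht)) (htK t le_rfl ht)

/-- The properties of the map that the thermodynamic argument uses. -/
structure IsPiecewiseMonotone (f : ℝ → ℝ) (X : Set ℝ) : Prop where
  Ioo_subset : Ioo 0 1 ⊆ X
  subset_Icc : X ⊆ Icc 0 1
  mapsTo : MapsTo f X X
  finite_exceptional : (Icc (0 : ℝ) 1 \ ⋃₀ branches f).Finite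
  -- Excludes two fixed points of `fⁿ` in one cylinder.
  not_invariant : ∀ n ≥ 1, ∀ p q : ℝ, 0 < p → p < q → q < 1 → ¬ MapsTo f^[n] (Icc p q) (Icc p q)
  -- The form of exactness that suits loops `D → ⋯ → D` in the graph of domains.
  covers : ∀ D : Set ℝ, IsOpen D → D.OrdConnected → D.Nonempty → D ⊆ Ioo 0 1 →
    ∀ k ≥ 1, D ⊆ f^[k] '' D → ∃ N, Ioo 0 1 ⊆ f^[N] '' D

/-! ### Cylinders -/

/-- The set of points of `(0,1)` with itinerary `A` up to time `n`. -/
def itinerary (f : ℝ → ℝ) (n : ℕ) (A : ℕ → Set ℝ) : Set ℝ :=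
  {x ∈ Ioo (0 : ℝ) 1 | ∀ i < n, f^[i] x ∈ A i}

theorem itinerary_succ (f : ℝ → ℝ) (n : ℕ) (A : ℕ → Set ℝ) :
    itinerary f (n + 1) A = itinerary f n A ∩ f^[n] ⁻¹' A n := by
  ext x
  simp only [itinerary, mem_ofPred_eq, mem_inter_iff, mem_preimage, Nat.lt_succ_iff_lt_or_eq]
  constructor
  · rintro ⟨h, h'⟩
    exact ⟨⟨h, fun i hi => h' i (Or.inl hi)⟩, h' n (Or.inr rfl)⟩
  · rintro ⟨⟨h, h'⟩, h''⟩
    refine ⟨h, ?_⟩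
    rintro i (hi | rfl)
    exacts [h' i hi, h'']

theorem itinerary_anti (f : ℝ → ℝ) {m n : ℕ} (hmn : m ≤ n) (A : ℕ → Set ℝ) :
    itinerary f n A ⊆ itinerary f m A :=
  fun _ hx => ⟨hx.1, fun i hi => hx.2 i (hi.trans_le hmn)⟩

/-- By induction: each further condition intersects with the preimage of an open interval under a
continuous monotone map, so an open interval remains. -/
theorem itinerary_isOpen {f : ℝ → ℝ} {n : ℕ} {A : ℕ → Set ℝ} (hA : ∀ i < n, A i ∈ branches f) :
    IsOpen (itinerary f n A) ∧ (itinerary f n A).OrdConnected ∧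
      ContinuousOn f^[n] (itinerary f n A) ∧
      (StrictMonoOn f^[n] (itinerary f n A) ∨ StrictAntiOn f^[n] (itinerary f n A)) := by
  induction n with
  | zero =>
    have : itinerary f 0 A = Ioo 0 1 := by ext; simp [itinerary]
    rw [this]
    exact ⟨isOpen_Ioo, ordConnected_Ioo, continuousOn_id, Or.inl (strictMono_id.strictMonoOn _)⟩
  | succ n ih =>
    obtain ⟨ho, hoc, hc, hs⟩ := ih fun i hi => hA i (by omega)
    have hAn := (hA n (by omega)).prop
    have hsub : itinerary f (n + 1) A ⊆ itinerary f n A := itinerary_anti f (Nat.le_succ n) A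
    have hmaps : MapsTo f^[n] (itinerary f (n + 1) A) (A n) := fun x hx => hx.2 n (by omega)
    refine ⟨?_, ?_, ?_, ?_⟩
    · rw [itinerary_succ]
      exact hc.isOpen_inter_preimage ho hAn.isOpen
    · refine ⟨fun x hx y hy z hz => ?_⟩
      rw [itinerary_succ]
      have hzn : z ∈ itinerary f n A := hoc.out (hsub hx) (hsub hy) hz
      refine ⟨hzn, ?_⟩
      rcases hs with hs | hs
      · exact hAn.ordConnected.out (hmaps hx) (hmaps hy)
          ⟨hs.monotoneOn (hsub hx) hzn hz.1, hs.monotoneOn hzn (hsub hy) hz.2⟩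
      · exact hAn.ordConnected.out (hmaps hy) (hmaps hx)
          ⟨hs.antitoneOn hzn (hsub hy) hz.2, hs.antitoneOn (hsub hx) hzn hz.1⟩
    · rw [Function.iterate_succ']
      exact hAn.continuousOn.comp (hc.mono hsub) hmaps
    · rw [Function.iterate_succ']
      rcases hs with hs | hs <;> rcases hAn.strict with hs' | hs'
      · exact Or.inl (hs'.comp (hs.mono hsub) hmaps)
      · exact Or.inr (hs'.comp_strictMonoOn (hs.mono hsub) hmaps)
      · exact Or.inr (hs'.comp_strictAntiOn (hs.mono hsub) hmaps)
      · exact Or.inl (hs'.comp (hs.mono hsub) hmaps)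

section cylinders

variable {f : ℝ → ℝ} {X C C' D : Set ℝ} {n m : ℕ}

theorem cylinder_subset (hC : C ∈ cylinders f n) : C ⊆ Ioo 0 1 := by
  obtain ⟨-, A, -, rfl⟩ := hC
  exact fun x hx => hx.1

theorem cylinder_isOpen (hC : C ∈ cylinders f n) : IsOpen C := by
  obtain ⟨-, A, hA, rfl⟩ := hC
  exact (itinerary_isOpen hA).1

theorem cylinder_ordConnected (hC : C ∈ cylinders f n) : C.OrdConnected := by
  obtain ⟨-, A, hA, rfl⟩ := hC
  exact (itinerary_isOpen hA).2.1

theorem cylinder_continuousOn (hC : C ∈ cylinders f n) (hm : m ≤ n) : ContinuousOn f^[m] C := by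
  obtain ⟨-, A, hA, rfl⟩ := hC
  exact (itinerary_isOpen fun i hi => hA i (hi.trans_le hm)).2.2.1.mono (itinerary_anti f hm A)

theorem cylinder_strict (hC : C ∈ cylinders f n) (hm : m ≤ n) :
    StrictMonoOn f^[m] C ∨ StrictAntiOn f^[m] C := by
  obtain ⟨-, A, hA, rfl⟩ := hC
  exact (itinerary_isOpen fun i hi => hA i (hi.trans_le hm)).2.2.2.imp
    (fun h => h.mono (itinerary_anti f hm A)) (fun h => h.mono (itinerary_anti f hm A))

/-- Cylinders of the same order are equal or disjoint. -/
theorem cylinder_eq (hC : C ∈ cylinders f n) (hC' : C' ∈ cylinders f n) {x : ℝ} (hx : x ∈ C)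
    (hx' : x ∈ C') : C = C' := by
  obtain ⟨-, A, hA, rfl⟩ := hC
  obtain ⟨-, B, hB, rfl⟩ := hC'
  have : ∀ i < n, A i = B i := fun i hi => branches_eq (hA i hi) (hB i hi) (hx.2 i hi) (hx'.2 i hi)
  ext y
  exact ⟨fun hy => ⟨hy.1, fun i hi => this i hi ▸ hy.2 i hi⟩,
    fun hy => ⟨hy.1, fun i hi => (this i hi).symm ▸ hy.2 i hi⟩⟩

theorem exists_cylinder {x : ℝ} (hx : x ∈ Ioo (0 : ℝ) 1) (h : ∀ i < n, f^[i] x ∈ ⋃₀ branches f) :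
    ∃ C ∈ cylinders f n, x ∈ C := by
  choose! A hA hxA using h
  exact ⟨itinerary f n A, ⟨⟨x, hx, hxA⟩, A, hA, rfl⟩, hx, hxA⟩

theorem cylinders_finite (hf : IsPiecewiseMonotone f X) (n : ℕ) : (cylinders f n).Finite := by
  have hb : Finite (branches f) := (branches_finite_of_exceptional hf.finite_exceptional).to_subtype
  refine (finite_range fun A : Fin n → branches f =>
    {x ∈ Ioo (0 : ℝ) 1 | ∀ i : Fin n, f^[i] x ∈ (A i : Set ℝ)}).subset ?_
  rintro C ⟨-, A, hA, rfl⟩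
  refine ⟨fun i => ⟨A i, hA i i.2⟩, ?_⟩
  ext x
  simp only [mem_ofPred_eq]
  exact ⟨fun h => ⟨h.1, fun i hi => h.2 ⟨i, hi⟩⟩, fun h => ⟨h.1, fun i => h.2 i i.2⟩⟩

theorem mapsTo_iterate (hf : IsPiecewiseMonotone f X) (n : ℕ) : MapsTo f^[n] X X :=
  hf.mapsTo.iterate n

/-- Only finitely many points leave the union of the branches before time `n`. -/
theorem finite_exceptional_iterate (hf : IsPiecewiseMonotone f X) (n : ℕ) :
    {x ∈ X | ∃ i < n, f^[i] x ∉ ⋃₀ branches f}.Finite := by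
  have hb := branches_finite_of_exceptional hf.finite_exceptional
  -- `f` is injective on each of the finitely many branches, so preimages of finite sets are finite.
  have hpre : ∀ S : Set ℝ, S.Finite → (X ∩ f ⁻¹' S).Finite := by
    intro S hS
    have h1 : (⋃ A ∈ branches f, A ∩ f ⁻¹' S).Finite := by
      refine hb.biUnion fun A hA => Set.Finite.of_finite_image (f := f)
        (hS.subset (by rintro _ ⟨x, hx, rfl⟩; exact hx.2)) ?_
      exact (hA.prop.strict.elim (fun h => h.injOn) (fun h => h.injOn)).mono inter_subset_left
    refine (h1.union hf.finite_exceptional).subset ?_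
    rintro x ⟨hx, hxS⟩
    by_cases h : x ∈ ⋃₀ branches f
    · obtain ⟨A, hA, hxA⟩ := h
      exact Or.inl (mem_biUnion hA ⟨hxA, hxS⟩)
    · exact Or.inr ⟨hf.subset_Icc hx, h⟩
  have hex : ∀ i, {x ∈ X | f^[i] x ∉ ⋃₀ branches f}.Finite := by
    intro i
    induction i with
    | zero => exact hf.finite_exceptional.subset fun x hx => ⟨hf.subset_Icc hx.1, hx.2⟩
    | succ i ih =>
      refine (hpre _ ih).subset fun x hx => ⟨hx.1, hf.mapsTo hx.1, ?_⟩
      simpa using hx.2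
  refine ((finite_lt_nat n).biUnion fun i _ => hex i).subset ?_
  rintro x ⟨hx, i, hi, h⟩
  exact mem_biUnion hi ⟨hx, h⟩

/-- The image of an open subinterval of a cylinder is an open interval inside `(0,1)`. -/
theorem image_cylinder (hf : IsPiecewiseMonotone f X) (hC : C ∈ cylinders f n) (hD : IsOpen D)
    (hDo : D.OrdConnected) : IsOpen (f^[n] '' (D ∩ C)) ∧ (f^[n] '' (D ∩ C)).OrdConnected ∧
      f^[n] '' (D ∩ C) ⊆ Ioo 0 1 := by
  have hoc : (D ∩ C).OrdConnected := hDo.inter (cylinder_ordConnected hC)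
  have hc : ContinuousOn f^[n] (D ∩ C) := (cylinder_continuousOn hC le_rfl).mono inter_subset_right
  have ho : IsOpen (f^[n] '' (D ∩ C)) :=
    isOpen_image_of_strict (hD.inter (cylinder_isOpen hC)) hoc hc
      ((cylinder_strict hC le_rfl).imp (fun h => h.mono inter_subset_right)
        (fun h => h.mono inter_subset_right))
  refine ⟨ho, (hoc.isPreconnected.image _ hc).ordConnected, ?_⟩
  -- An open subset of `[0,1]` lies in the interior, so the image misses both endpoints.
  rw [← interior_Icc]
  refine ho.subset_interior_iff.2 ?_
  rintro _ ⟨x, hx, rfl⟩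
  exact hf.subset_Icc (mapsTo_iterate hf n (hf.Ioo_subset (cylinder_subset hC hx.2)))

theorem iterate_cylinder_mem (hf : IsPiecewiseMonotone f X) (hC : C ∈ cylinders f n) {x : ℝ}
    (hx : x ∈ C) : f^[n] x ∈ Ioo (0 : ℝ) 1 :=
  (image_cylinder hf hC isOpen_univ ordConnected_univ).2.2 ⟨x, ⟨trivial, hx⟩, rfl⟩

/-- The second factor requires `fⁿ x` to lie in the open interval `(0,1)`; this is supplied by
`iterate_cylinder_mem`. -/
theorem itinerary_add (hf : IsPiecewiseMonotone f X) {A : ℕ → Set ℝ}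
    (hA : ∀ i < n, A i ∈ branches f) (m : ℕ) : itinerary f (n + m) A =
      itinerary f n A ∩ f^[n] ⁻¹' itinerary f m fun i => A (n + i) := by
  ext x
  constructor
  · intro hx
    have hxn : x ∈ itinerary f n A := itinerary_anti f (Nat.le_add_right n m) A hx
    refine ⟨hxn, iterate_cylinder_mem hf ⟨⟨x, hxn⟩, A, hA, rfl⟩ hxn, fun i hi => ?_⟩
    rw [← Function.iterate_add_apply, add_comm]
    exact hx.2 (n + i) (by omega)
  · rintro ⟨hx, hx'⟩
    refine ⟨hx.1, fun i hi => ?_⟩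
    rcases lt_or_ge i n with h | h
    · exact hx.2 i h
    · obtain ⟨j, rfl⟩ := Nat.exists_eq_add_of_le h
      rw [add_comm n j, Function.iterate_add_apply, add_comm j n]
      exact hx'.2 j (by omega)

/-- Concatenation of cylinders. -/
theorem concat_mem_cylinders (hf : IsPiecewiseMonotone f X) (hC : C ∈ cylinders f n)
    (hC' : C' ∈ cylinders f m) (h : (C ∩ f^[n] ⁻¹' C').Nonempty) :
    C ∩ f^[n] ⁻¹' C' ∈ cylinders f (n + m) := by
  refine ⟨h, ?_⟩
  obtain ⟨-, A, hA, rfl⟩ := hC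
  obtain ⟨-, B, hB, rfl⟩ := hC'
  have h1 : ∀ i < n, (if i < n then A i else B (i - n)) = A i := fun i hi => if_pos hi
  refine ⟨fun i => if i < n then A i else B (i - n), fun i hi => ?_, ?_⟩
  · dsimp only
    split_ifs with h
    exacts [hA i h, hB _ (by omega)]
  · refine Eq.trans ?_ (itinerary_add hf (fun i hi => (h1 i hi).symm ▸ hA i hi) m).symm
    congr 1
    · ext x
      exact and_congr_right fun _ => forall₂_congr fun i hi => by
        rw [show (fun i => if i < n then A i else B (i - n)) i = A i from h1 i hi]
    · simp only [add_lt_iff_neg_left, not_lt_zero, if_false, Nat.add_sub_cancel_left]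
      rfl

theorem exists_concat_eq (hf : IsPiecewiseMonotone f X) (hC : C ∈ cylinders f (n + m)) :
    ∃ C₁ ∈ cylinders f n, ∃ C₂ ∈ cylinders f m, C = C₁ ∩ f^[n] ⁻¹' C₂ := by
  obtain ⟨⟨x, hx⟩, A, hA, rfl⟩ := hC
  have hA' : ∀ i < n, A i ∈ branches f := fun i hi => hA i (by omega)
  have key := itinerary_add hf hA' m
  have hx' : x ∈ itinerary f (n + m) A := hx
  rw [key] at hx'
  exact ⟨_, ⟨⟨x, hx'.1⟩, A, hA', rfl⟩, itinerary f m fun i => A (n + i),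
    ⟨⟨_, hx'.2⟩, _, fun i hi => hA (n + i) (by omega), rfl⟩, key⟩

theorem image_concat (D C C' : Set ℝ) (f : ℝ → ℝ) (n m : ℕ) :
    f^[n + m] '' (D ∩ (C ∩ f^[n] ⁻¹' C')) = f^[m] '' (f^[n] '' (D ∩ C) ∩ C') := by
  rw [add_comm n m, Function.iterate_add, image_comp, ← inter_assoc, image_inter_preimage]

end cylinders

/-! ### The tower -/

section tower

variable {f φ : ℝ → ℝ} {X C C' D D' : Set ℝ} {E : Set (Set ℝ)} {n m : ℕ} {x : ℝ}

theorem domain_props (hf : IsPiecewiseMonotone f X) (hD : D ∈ domains f) :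
    IsOpen D ∧ D.OrdConnected ∧ D.Nonempty ∧ D ⊆ Ioo 0 1 := by
  obtain ⟨n, C, hC, rfl⟩ := hD
  have := image_cylinder hf hC isOpen_univ ordConnected_univ
  rw [univ_inter] at this
  exact ⟨this.1, this.2.1, hC.1.image _, this.2.2⟩

theorem hatMap_of_mem {A : Set ℝ} (hA : A ∈ branches f) (hx : x ∈ A) (D : Set ℝ) :
    hatMap f (x, D) = (f x, f '' (D ∩ A)) := by
  simp only [hatMap, Prod.mk.injEq, true_and]
  congr 1
  ext y
  constructor
  · rintro ⟨hy, A', hA', hxA', hyA'⟩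
    exact ⟨hy, branches_eq hA' hA hxA' hx ▸ hyA'⟩
  · rintro ⟨hy, hyA⟩
    exact ⟨hy, A, hA, hx, hyA⟩

theorem hatMap_iterate_of_mem (hC : C ∈ cylinders f n) (hx : x ∈ C) (hD : D ⊆ Ioo 0 1) :
    (hatMap f)^[n] (x, D) = (f^[n] x, f^[n] '' (D ∩ C)) := by
  obtain ⟨-, A, hA, rfl⟩ := hC
  change x ∈ itinerary f n A at hx
  change _ = (f^[n] x, f^[n] '' (D ∩ itinerary f n A))
  induction n with
  | zero =>
    have : D ∩ itinerary f 0 A = D := inter_eq_left.2 fun y hy => ⟨hD hy, by simp⟩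
    simp [this]
  | succ n ih =>
    rw [Function.iterate_succ_apply', ih (fun i hi => hA i (by omega))
      (itinerary_anti f (Nat.le_succ n) A hx),
      hatMap_of_mem (hA n (by omega)) (hx.2 n (by omega)), itinerary_succ, ← inter_assoc,
      Function.iterate_succ', image_comp, image_inter_preimage]
    rfl

theorem hatMap_iterate_fst (p : ℝ × Set ℝ) (n : ℕ) : ((hatMap f)^[n] p).1 = f^[n] p.1 := by
  induction n with
  | zero => rfl
  | succ n ih => rw [Function.iterate_succ_apply', Function.iterate_succ_apply', ← ih]; rfl

theorem birkhoffSum_hatMap (p : ℝ × Set ℝ) (n : ℕ) :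
    birkhoffSum (hatMap f) (hatPot φ) n p = birkhoffSum f φ n p.1 := by
  simp only [birkhoffSum, hatPot, hatMap_iterate_fst]

/-- Periodic points of the tower follow an itinerary. -/
theorem exists_cylinder_of_periodic (hx : x ∈ D) (hD : D ⊆ Ioo 0 1)
    (h : (hatMap f)^[n] (x, D) = (x, D)) : ∃ C ∈ cylinders f n, x ∈ C := by
  by_contra hcon
  have : ∃ i < n, f^[i] x ∉ ⋃₀ branches f := by
    by_contra! h'
    exact hcon (exists_cylinder (hD hx) h')
  obtain ⟨i, hi, hxi⟩ := this
  -- Once the orbit has left the branches the second coordinate is `∅` forever, so the point cannot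
  -- return to a level containing `x`.
  have hempty : ∀ j, ((hatMap f)^[j + (i + 1)] (x, D)).2 = ∅ := by
    intro j
    induction j with
    | zero =>
      rw [zero_add, Function.iterate_succ_apply', hatMap, hatMap_iterate_fst]
      simp only [image_eq_empty]
      refine eq_empty_of_forall_notMem ?_
      rintro y ⟨-, A, hA, hA', -⟩
      exact hxi ⟨A, hA, hA'⟩
    | succ j ih =>
      rw [show j + 1 + (i + 1) = (j + (i + 1)) + 1 by omega, Function.iterate_succ_apply', hatMap,
        ih]
      simp
  have h1 := hempty (n - (i + 1))
  rw [Nat.sub_add_cancel (by omega), h] at h1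
  simp only at h1
  rw [h1] at hx
  exact hx

/-- An arrow depends on `D` alone and not on the cylinder representing it. Paths from `D` therefore
correspond to cylinders that meet `D`. -/
theorem Arrow.exists_cylinder (hf : IsPiecewiseMonotone f X) (h : Arrow f D D') :
    ∃ A ∈ cylinders f 1, (D ∩ A).Nonempty ∧ f^[1] '' (D ∩ A) = D' := by
  obtain ⟨m, C, hC, C', hC', hsub, rfl, rfl⟩ := h
  obtain ⟨C₁, hC₁, A, hA, rfl⟩ := exists_concat_eq hf hC'
  obtain ⟨z, hz⟩ := hC'.1
  obtain rfl : C₁ = C := cylinder_eq hC₁ hC hz.1 (hsub hz)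
  refine ⟨A, hA, ⟨f^[m] z, ⟨z, hz.1, rfl⟩, hz.2⟩, ?_⟩
  have := image_concat univ C₁ A f m 1
  simpa only [univ_inter] using this.symm

theorem arrow_of_cylinder (hf : IsPiecewiseMonotone f X) (hD : D ∈ domains f)
    (hC : C ∈ cylinders f 1) (h : (D ∩ C).Nonempty) : Arrow f D (f^[1] '' (D ∩ C)) := by
  obtain ⟨m, C₀, hC₀, rfl⟩ := hD
  obtain ⟨_, ⟨z, hz, rfl⟩, hzC⟩ := h
  refine ⟨m, C₀, hC₀, C₀ ∩ f^[m] ⁻¹' C, concat_mem_cylinders hf hC₀ hC ⟨z, hz, hzC⟩,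
    inter_subset_left, rfl, ?_⟩
  have := image_concat univ C₀ C f m 1
  simpa only [univ_inter] using this.symm

theorem Ioo_mem_cylinders_zero (f : ℝ → ℝ) : Ioo (0 : ℝ) 1 ∈ cylinders f 0 :=
  ⟨⟨1 / 2, by norm_num⟩, fun _ => univ, by simp, by ext; simp⟩

theorem cylinder_zero (hC : C ∈ cylinders f 0) : C = Ioo 0 1 := by
  obtain ⟨x, hx⟩ := hC.1
  exact cylinder_eq hC (Ioo_mem_cylinders_zero f) hx (cylinder_subset hC hx)

theorem HasPath.exists_cylinder (hf : IsPiecewiseMonotone f X) (hD : D ∈ domains f)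
    (h : HasPath f n D D') :
    ∃ C ∈ cylinders f n, (D ∩ C).Nonempty ∧ f^[n] '' (D ∩ C) = D' := by
  obtain ⟨p, hp0, rfl, hp⟩ := h
  induction n with
  | zero =>
    obtain ⟨-, -, hne, hsub⟩ := domain_props hf hD
    refine ⟨Ioo 0 1, Ioo_mem_cylinders_zero f, ?_, ?_⟩ <;> simp [inter_eq_left.2 hsub, hne, hp0]
  | succ n ih =>
    obtain ⟨C, hC, hne, himg⟩ := ih fun k hk => hp k (by omega)
    obtain ⟨A, hA, hne', himg'⟩ := (hp n (by omega)).exists_cylinder hf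
    rw [← himg] at hne' himg'
    obtain ⟨_, ⟨z, hz, rfl⟩, hzA⟩ := hne'
    refine ⟨C ∩ f^[n] ⁻¹' A, concat_mem_cylinders hf hC hA ⟨z, hz.2, hzA⟩, ⟨z, hz.1, hz.2, hzA⟩, ?_⟩
    rw [image_concat, himg']

theorem IsTransitivePart.image_mem (hf : IsPiecewiseMonotone f X) (hE : IsTransitivePart f E)
    (hD : D ∈ E) (hC : C ∈ cylinders f n) (h : (D ∩ C).Nonempty) : f^[n] '' (D ∩ C) ∈ E := by
  induction n generalizing C with
  | zero =>
    rw [cylinder_zero hC, inter_eq_left.2 (domain_props hf (hE.subset hD)).2.2.2]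
    simpa using hD
  | succ n ih =>
    obtain ⟨C₁, hC₁, A, hA, rfl⟩ := exists_concat_eq hf hC
    obtain ⟨z, hzD, hz, hzA⟩ := h
    have h1 := ih hC₁ ⟨z, hzD, hz⟩
    rw [image_concat]
    exact hE.closed _ h1 _ (arrow_of_cylinder hf (hE.subset h1) hA ⟨_, ⟨z, ⟨hzD, hz⟩, rfl⟩, hzA⟩)

/-- Every domain of the transitive part is eventually mapped over `(0,1)`. -/
theorem IsTransitivePart.exists_cover (hf : IsPiecewiseMonotone f X) (hE : IsTransitivePart f E)
    (hD : D ∈ E) : ∃ N, Ioo 0 1 ⊆ f^[N] '' D := by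
  obtain ⟨k, hk, hk1⟩ := ((hE.primitive D hD D hD).and (eventually_ge_atTop 1)).exists
  obtain ⟨C, -, -, himg⟩ := hk.exists_cylinder hf (hE.subset hD)
  obtain ⟨ho, hoc, hne, hsub⟩ := domain_props hf (hE.subset hD)
  refine hf.covers D ho hoc hne hsub k hk1 ?_
  calc D = f^[k] '' (D ∩ C) := himg.symm
    _ ⊆ f^[k] '' D := image_mono inter_subset_left

end tower

/-! ### Partition sums -/

/-- The exponential, with values in `[0,∞]`. -/
def expE (r : ℝ) : ENNReal := ENNReal.ofReal (Real.exp r)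

theorem expE_add (r s : ℝ) : expE (r + s) = expE r * expE s := by
  rw [expE, Real.exp_add, ENNReal.ofReal_mul (Real.exp_pos r).le]; rfl

theorem expE_mono : Monotone expE := fun _ _ h => ENNReal.ofReal_le_ofReal (Real.exp_le_exp.2 h)

theorem expE_ne_zero (r : ℝ) : expE r ≠ 0 := by simp [expE, Real.exp_pos]

theorem expE_ne_top (r : ℝ) : expE r ≠ ⊤ := ENNReal.ofReal_ne_top

theorem expE_zero : expE 0 = 1 := by simp [expE]

theorem log_expE (r : ℝ) : ENNReal.log (expE r) = r := by
  rw [expE, ENNReal.log_ofReal_of_pos (Real.exp_pos r), Real.log_exp]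

/-- Most comparisons of partition sums below inject one index set into another, with weights that do
not decrease. -/
theorem tsum_le_tsum_of_injective {α β : Type*} {u : α → ENNReal} {v : β → ENNReal} (i : α → β)
    (hi : Function.Injective i) (h : ∀ a, u a ≤ v (i a)) : ∑' a, u a ≤ ∑' b, v b :=
  (ENNReal.tsum_le_tsum h).trans (ENNReal.tsum_comp_le_tsum_of_injective hi v)

/-- The weight `sup_C exp φₙ` of a cylinder. -/
def cylWeight (f φ : ℝ → ℝ) (n : ℕ) (C : Set ℝ) : ENNReal :=
  ⨆ x ∈ C, expE (birkhoffSum f φ n x)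

/-- The sum of the weights of the `n`-cylinders that meet `D`. -/
def meetSum (f φ : ℝ → ℝ) (n : ℕ) (D : Set ℝ) : ENNReal :=
  ∑' C : {C // C ∈ cylinders f n ∧ (D ∩ C).Nonempty}, cylWeight f φ n C

/-- The sum of the weights of the `n`-cylinders `C` that meet `D` and for which `fⁿ (D ∩ C)`
belongs to the family `F`. -/
def returnSum (f φ : ℝ → ℝ) (n : ℕ) (D : Set ℝ) (F : Set (Set ℝ)) : ENNReal :=
  ∑' C : {C // C ∈ cylinders f n ∧ (D ∩ C).Nonempty ∧ f^[n] '' (D ∩ C) ∈ F}, cylWeight f φ n C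

section sums

variable {f φ : ℝ → ℝ} {X C C' D D' : Set ℝ} {E : Set (Set ℝ)} {n m : ℕ} {x : ℝ} {a b : ℝ}

theorem le_cylWeight (hx : x ∈ C) : expE (birkhoffSum f φ n x) ≤ cylWeight f φ n C :=
  le_iSup₂_of_le x hx le_rfl

theorem birkhoffSum_lower (hf : IsPiecewiseMonotone f X) (ha : ∀ x ∈ X, a ≤ φ x) (hx : x ∈ X)
    (n : ℕ) : n * a ≤ birkhoffSum f φ n x := by
  have := Finset.card_nsmul_le_sum (Finset.range n) (fun k => φ (f^[k] x)) a
    fun k _ => ha _ (mapsTo_iterate hf k hx)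
  simpa [birkhoffSum] using this

theorem birkhoffSum_upper (hf : IsPiecewiseMonotone f X) (hb : ∀ x ∈ X, φ x ≤ b) (hx : x ∈ X)
    (n : ℕ) : birkhoffSum f φ n x ≤ n * b := by
  have := Finset.sum_le_card_nsmul (Finset.range n) (fun k => φ (f^[k] x)) b
    fun k _ => hb _ (mapsTo_iterate hf k hx)
  simpa [birkhoffSum] using this

theorem abs_sub_le_beta (hf : IsPiecewiseMonotone f X) (ha : ∀ x ∈ X, a ≤ φ x)
    (hb : ∀ x ∈ X, φ x ≤ b) (hC : C ∈ cylinders f n) {y : ℝ} (hx : x ∈ C) (hy : y ∈ C) :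
    |birkhoffSum f φ n x - birkhoffSum f φ n y| ≤ beta f φ n := by
  refine le_csSup ⟨n * b - n * a, ?_⟩ ⟨C, hC, x, hx, y, hy, rfl⟩
  rintro _ ⟨C, hC, x, hx, y, hy, rfl⟩
  have hx' := hf.Ioo_subset (cylinder_subset hC hx)
  have hy' := hf.Ioo_subset (cylinder_subset hC hy)
  have h1 := birkhoffSum_lower hf ha hx' n
  have h2 := birkhoffSum_lower hf ha hy' n
  have h3 := birkhoffSum_upper hf hb hx' n
  have h4 := birkhoffSum_upper hf hb hy' n
  rw [abs_le]
  constructor <;> linarith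

/-- Distortion estimate for a point whose orbit passes through a cylinder. -/
theorem cylWeight_mul_le (hf : IsPiecewiseMonotone f X) (ha : ∀ x ∈ X, a ≤ φ x)
    (hb : ∀ x ∈ X, φ x ≤ b) (hC : C ∈ cylinders f m) (p q : ℕ) (hx : x ∈ X) (hxC : f^[p] x ∈ C) :
    expE (((p + q : ℕ) : ℝ) * a - beta f φ m) * cylWeight f φ m C ≤
      expE (birkhoffSum f φ (p + m + q) x) := by
  have h1 : cylWeight f φ m C ≤ expE (birkhoffSum f φ m (f^[p] x) + beta f φ m) := by
    refine iSup₂_le fun y hy => expE_mono ?_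
    have := abs_sub_le_beta hf ha hb hC hy hxC
    linarith [le_abs_self (birkhoffSum f φ m y - birkhoffSum f φ m (f^[p] x))]
  refine (mul_le_mul_right h1 _).trans ?_
  rw [← expE_add]
  apply expE_mono
  have h2 := birkhoffSum_lower hf ha hx p
  have h3 := birkhoffSum_lower hf ha (mapsTo_iterate hf (p + m) hx) q
  rw [birkhoffSum_add, birkhoffSum_add]
  push_cast
  linarith

end sums

/-! ### Comparison of partition sums, tower sums and periodic sums -/

section estimates

variable {f φ : ℝ → ℝ} {X C C' D D' : Set ℝ} {E : Set (Set ℝ)} {n m k : ℕ} {x : ℝ} {a b : ℝ}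

theorem topSum_eq (f φ : ℝ → ℝ) (n : ℕ) :
    topSum f φ n = ∑' C : cylinders f n, cylWeight f φ n C := rfl

/-- Any infinite subset of `(0,1)` meets a cylinder. -/
theorem exists_cylinder_of_infinite (hf : IsPiecewiseMonotone f X) {S : Set ℝ} (hS : S.Infinite)
    (hS' : S ⊆ Ioo 0 1) (n : ℕ) : ∃ C ∈ cylinders f n, (S ∩ C).Nonempty := by
  obtain ⟨x, hx, hx'⟩ := hS.exists_notMem_finite (finite_exceptional_iterate hf n)
  obtain ⟨C, hC, hxC⟩ := exists_cylinder (n := n) (hS' hx) fun i hi => by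
    by_contra h
    exact hx' ⟨hf.Ioo_subset (hS' hx), i, hi, h⟩
  exact ⟨C, hC, x, hx, hxC⟩

theorem cylinders_nonempty (hf : IsPiecewiseMonotone f X) (n : ℕ) : (cylinders f n).Nonempty := by
  obtain ⟨C, hC, -⟩ := exists_cylinder_of_infinite hf (Ioo_infinite zero_lt_one) Subset.rfl n
  exact ⟨C, hC⟩

theorem cylWeight_le (hf : IsPiecewiseMonotone f X) (hb : ∀ x ∈ X, φ x ≤ b)
    (hC : C ∈ cylinders f n) : cylWeight f φ n C ≤ expE (n * b) :=
  iSup₂_le fun _ hx =>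
    expE_mono (birkhoffSum_upper hf hb (hf.Ioo_subset (cylinder_subset hC hx)) n)

theorem le_cylWeight_of_lower (hf : IsPiecewiseMonotone f X) (ha : ∀ x ∈ X, a ≤ φ x)
    (hC : C ∈ cylinders f n) : expE (n * a) ≤ cylWeight f φ n C := by
  obtain ⟨x, hx⟩ := hC.1
  exact (expE_mono (birkhoffSum_lower hf ha (hf.Ioo_subset (cylinder_subset hC hx)) n)).trans
    (le_cylWeight hx)

theorem tsum_const_cylinders (hf : IsPiecewiseMonotone f X) (n : ℕ) (c : ENNReal) :
    ∑' _ : cylinders f n, c = (cylinders f n).ncard * c := by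
  have := (cylinders_finite hf n).fintype
  rw [tsum_fintype, Finset.sum_const, nsmul_eq_mul, Finset.card_univ, ← Nat.card_eq_fintype_card]
  rfl

theorem topSum_le (hf : IsPiecewiseMonotone f X) (hb : ∀ x ∈ X, φ x ≤ b) (n : ℕ) :
    topSum f φ n ≤ (cylinders f n).ncard * expE (n * b) := by
  rw [← tsum_const_cylinders hf, topSum_eq]
  exact ENNReal.tsum_le_tsum fun C => cylWeight_le hf hb C.2

theorem le_topSum (hf : IsPiecewiseMonotone f X) (ha : ∀ x ∈ X, a ≤ φ x) (n : ℕ) :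
    (cylinders f n).ncard * expE (n * a) ≤ topSum f φ n := by
  rw [← tsum_const_cylinders hf, topSum_eq]
  exact ENNReal.tsum_le_tsum fun C => le_cylWeight_of_lower hf ha C.2

theorem topSum_ne_top (hf : IsPiecewiseMonotone f X) (hb : ∀ x ∈ X, φ x ≤ b) (n : ℕ) :
    topSum f φ n ≠ ⊤ :=
  ((topSum_le hf hb n).trans_lt
    (ENNReal.mul_lt_top (ENNReal.natCast_lt_top _) (expE_ne_top _).lt_top)).ne

theorem one_le_ncard_cylinders (hf : IsPiecewiseMonotone f X) (n : ℕ) :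
    1 ≤ (cylinders f n).ncard :=
  (ncard_pos (cylinders_finite hf n)).2 (cylinders_nonempty hf n)

theorem expE_le_topSum (hf : IsPiecewiseMonotone f X) (ha : ∀ x ∈ X, a ≤ φ x) (n : ℕ) :
    expE (n * a) ≤ topSum f φ n := by
  refine le_trans ?_ (le_topSum hf ha n)
  exact le_mul_of_one_le_left zero_le (mod_cast one_le_ncard_cylinders hf n)

theorem cylWeight_concat_le (C C' : Set ℝ) :
    cylWeight f φ (n + m) (C ∩ f^[n] ⁻¹' C') ≤ cylWeight f φ n C * cylWeight f φ m C' := by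
  refine iSup₂_le fun x hx => ?_
  rw [birkhoffSum_add, expE_add]
  exact mul_le_mul' (le_cylWeight hx.1) (le_cylWeight hx.2)

/-- A cylinder of order `n + m` is determined by its first `n` and its last `m` steps. This is the
input of Fekete's lemma. -/
theorem topSum_add_le (hf : IsPiecewiseMonotone f X) (n m : ℕ) :
    topSum f φ (n + m) ≤ topSum f φ n * topSum f φ m := by
  have h : ∀ C : cylinders f (n + m), ∃ p : cylinders f n × cylinders f m,
      (C : Set ℝ) = (p.1 : Set ℝ) ∩ f^[n] ⁻¹' (p.2 : Set ℝ) := fun C => by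
    obtain ⟨C₁, h₁, C₂, h₂, h⟩ := exists_concat_eq hf C.2
    exact ⟨(⟨C₁, h₁⟩, ⟨C₂, h₂⟩), h⟩
  choose p hp using h
  have hprod : topSum f φ n * topSum f φ m =
      ∑' q : cylinders f n × cylinders f m, cylWeight f φ n q.1 * cylWeight f φ m q.2 := by
    rw [ENNReal.tsum_prod (f := fun (A : cylinders f n) (B : cylinders f m) =>
      cylWeight f φ n A * cylWeight f φ m B)]
    simp_rw [ENNReal.tsum_mul_left, ENNReal.tsum_mul_right]
    rfl
  rw [hprod, topSum_eq]
  refine tsum_le_tsum_of_injective p (fun C C' h => ?_) fun C => ?_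
  · exact Subtype.ext (by rw [hp C, hp C', h])
  · rw [hp C]
    exact cylWeight_concat_le _ _

/-- There is at most one fixed point of `fⁿ` in each `n`-cylinder. -/
theorem fixed_unique (hf : IsPiecewiseMonotone f X) (hn : 1 ≤ n) (hC : C ∈ cylinders f n) {y : ℝ}
    (hx : x ∈ C) (hy : y ∈ C) (hfx : f^[n] x = x) (hfy : f^[n] y = y) : x = y := by
  have key : ∀ {x y : ℝ}, x ∈ C → y ∈ C → f^[n] x = x → f^[n] y = y → ¬ x < y := by
    intro x y hx hy hfx hfy hxy
    have hx' := cylinder_subset hC hx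
    have hy' := cylinder_subset hC hy
    -- An increasing branch would leave `[x, y]` invariant; a decreasing one reverses the order of
    -- `x` and `y`, which cannot then both be fixed.
    rcases cylinder_strict hC le_rfl with hs | hs
    · refine hf.not_invariant n hn x y hx'.1 hxy hy'.2 fun z hz => ?_
      have hzC := (cylinder_ordConnected hC).out hx hy hz
      have h1 := hs.monotoneOn hx hzC hz.1
      have h2 := hs.monotoneOn hzC hy hz.2
      rw [hfx] at h1
      rw [hfy] at h2
      exact ⟨h1, h2⟩
    · have := hs hx hy hxy
      rw [hfx, hfy] at this
      exact this.not_gt hxy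
  exact le_antisymm (not_lt.1 (key hy hx hfy hfx)) (not_lt.1 (key hx hy hfx hfy))

/-- A periodic point of the tower stays in the branches, hence lies in a cylinder, and it is the
only one there by `fixed_unique`. -/
theorem hatZ_le_topSum (hf : IsPiecewiseMonotone f X) (hD : D ⊆ Ioo 0 1) (hn : 1 ≤ n) :
    hatZ f φ ((D ∩ C) ×ˢ {D}) n ≤ topSum f φ n := by
  have h : ∀ p : {p // p ∈ (D ∩ C) ×ˢ {D} ∧ (hatMap f)^[n] p = p}, ∃ A : cylinders f n,
      p.1.1 ∈ (A : Set ℝ) := by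
    rintro ⟨⟨x, D'⟩, ⟨hx, hD'⟩, hp⟩
    obtain rfl : D' = D := hD'
    obtain ⟨A, hA, hxA⟩ := exists_cylinder_of_periodic hx.1 hD hp
    exact ⟨⟨A, hA⟩, hxA⟩
  choose A hA using h
  refine tsum_le_tsum_of_injective A (fun p q hpq => ?_) fun p => ?_
  · have hfix : ∀ p : {p // p ∈ (D ∩ C) ×ˢ {D} ∧ (hatMap f)^[n] p = p}, f^[n] p.1.1 = p.1.1 := by
      intro p
      rw [← hatMap_iterate_fst, p.2.2]
    refine Subtype.ext (Prod.ext ?_ ?_)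
    · exact fixed_unique hf hn (A p).2 (hA p) (hpq ▸ hA q) (hfix p) (hfix q)
    · rw [p.2.1.2, q.2.1.2]
  · rw [birkhoffSum_hatMap]
    exact le_cylWeight (hA p)

theorem hatTopSum_le_topSum (D C : Set ℝ) (n : ℕ) :
    hatTopSum f φ ((D ∩ C) ×ˢ {D}) n ≤ topSum f φ n := by
  have h : ∀ J : {J // J ∈ hatCylinders f (domains f) n ∧ J ⊆ (D ∩ C) ×ˢ {D}},
      ∃ A : cylinders f n, (J : Set (ℝ × Set ℝ)) = (D ∩ A) ×ˢ {D} := by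
    rintro ⟨_, ⟨D', hD', A, hA, ⟨x, hx⟩, rfl⟩, hsub⟩
    obtain rfl : D' = D := (hsub (show (x, D') ∈ _ from ⟨hx, rfl⟩)).2
    exact ⟨⟨A, hA⟩, rfl⟩
  choose A hA using h
  refine tsum_le_tsum_of_injective A (fun J J' h => Subtype.ext ?_) fun J => ?_
  · rw [hA J, hA J', h]
  · refine iSup₂_le fun p hp => ?_
    rw [birkhoffSum_hatMap]
    rw [hA J] at hp
    exact le_cylWeight hp.1.2

/-- The order `k` of the tower cylinder is used up by the first `k` steps. After them any
`m`-cylinder meeting `f^k(D ∩ C)` is a legitimate continuation. -/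
theorem le_hatTopSum (hf : IsPiecewiseMonotone f X) (ha : ∀ x ∈ X, a ≤ φ x)
    (hb : ∀ x ∈ X, φ x ≤ b) (hD : D ∈ domains f) (hC : C ∈ cylinders f k) (m : ℕ) :
    expE ((k : ℝ) * a - beta f φ m) * meetSum f φ m (f^[k] '' (D ∩ C)) ≤
      hatTopSum f φ ((D ∩ C) ×ˢ {D}) (k + m) := by
  rw [meetSum, ← ENNReal.tsum_mul_left]
  have h : ∀ A : {A // A ∈ cylinders f m ∧ (f^[k] '' (D ∩ C) ∩ A).Nonempty},
      (D ∩ (C ∩ f^[k] ⁻¹' (A : Set ℝ))).Nonempty := by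
    rintro ⟨A, hA, _, ⟨x, hx, rfl⟩, hxA⟩
    exact ⟨x, hx.1, hx.2, hxA⟩
  refine tsum_le_tsum_of_injective (fun A => ⟨(D ∩ (C ∩ f^[k] ⁻¹' (A : Set ℝ))) ×ˢ {D},
    ⟨D, hD, _, concat_mem_cylinders hf hC A.2.1 ((h A).mono inter_subset_right), h A, rfl⟩,
    prod_mono (inter_subset_inter_right _ inter_subset_left) Subset.rfl⟩) (fun A B hAB => ?_)
    fun A => ?_
  · have hAB' : (D ∩ (C ∩ f^[k] ⁻¹' (A : Set ℝ))) ×ˢ {D} =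
        (D ∩ (C ∩ f^[k] ⁻¹' (B : Set ℝ))) ×ˢ {D} := congrArg Subtype.val hAB
    obtain ⟨x, hx⟩ := h A
    have hx' : (x, D) ∈ (D ∩ (C ∩ f^[k] ⁻¹' (A : Set ℝ))) ×ˢ {D} := ⟨hx, rfl⟩
    rw [hAB'] at hx'
    exact Subtype.ext (cylinder_eq A.2.1 B.2.1 hx.2.2 hx'.1.2.2)
  · obtain ⟨x, hx⟩ := h A
    refine le_iSup₂_of_le (x, D) ⟨hx, rfl⟩ ?_
    rw [birkhoffSum_hatMap]
    have := cylWeight_mul_le hf ha hb A.2.1 k 0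
      (hf.Ioo_subset (cylinder_subset hC hx.2.1)) hx.2.2
    rwa [add_zero, add_zero] at this

theorem meetSum_le_topSum (f φ : ℝ → ℝ) (n : ℕ) (D : Set ℝ) :
    meetSum f φ n D ≤ topSum f φ n :=
  tsum_le_tsum_of_injective (fun C => ⟨C, C.2.1⟩)
    (fun _ _ h => Subtype.ext (Subtype.mk.inj h)) fun _ => le_rfl

/-- If `f^N` maps `D` over `(0,1)`, every `m`-cylinder is visited from `D` at time `N`. -/
theorem exists_cylinder_of_cover (hf : IsPiecewiseMonotone f X) {N : ℕ} (hD : D ⊆ Ioo 0 1)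
    (hN : Ioo 0 1 ⊆ f^[N] '' D) (hC : C ∈ cylinders f m) :
    ∃ A ∈ cylinders f N, (D ∩ (A ∩ f^[N] ⁻¹' C)).Nonempty := by
  -- A single preimage could be one of the finitely many points without an `N`-cylinder; infinitely
  -- many cannot all be.
  have hinf : (D ∩ f^[N] ⁻¹' C).Infinite := by
    refine Set.Infinite.of_image f^[N] ?_
    rw [image_inter_preimage]
    have : f^[N] '' D ∩ C = C := inter_eq_right.2 ((cylinder_subset hC).trans hN)
    rw [this]
    obtain ⟨x, hx⟩ := hC.1
    exact infinite_of_mem_nhds x ((cylinder_isOpen hC).mem_nhds hx)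
  obtain ⟨A, hA, x, hx, hxA⟩ :=
    exists_cylinder_of_infinite hf hinf (inter_subset_left.trans hD) N
  exact ⟨A, hA, x, hx.1, hxA, hx.2⟩

/-- Every `m`-cylinder is reached from `D` at time `N`, and different ones give different cylinders
of order `N + m`. The free steps cost at most `exp(-Na)`, the choice of point `exp βₘ`. -/
theorem le_meetSum (hf : IsPiecewiseMonotone f X) (ha : ∀ x ∈ X, a ≤ φ x)
    (hb : ∀ x ∈ X, φ x ≤ b) {N : ℕ} (hD : D ⊆ Ioo 0 1) (hN : Ioo 0 1 ⊆ f^[N] '' D) (m : ℕ) :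
    expE ((N : ℝ) * a - beta f φ m) * topSum f φ m ≤ meetSum f φ (N + m) D := by
  rw [topSum_eq, ← ENNReal.tsum_mul_left]
  have h : ∀ C : cylinders f m, ∃ A ∈ cylinders f N,
      (D ∩ (A ∩ f^[N] ⁻¹' (C : Set ℝ))).Nonempty :=
    fun C => exists_cylinder_of_cover hf hD hN C.2
  choose A hA hne using h
  refine tsum_le_tsum_of_injective (fun C => ⟨A C ∩ f^[N] ⁻¹' (C : Set ℝ),
    concat_mem_cylinders hf (hA C) C.2 ((hne C).mono inter_subset_right), hne C⟩)
    (fun B C hBC => ?_) fun C => ?_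
  · have hBC' : A B ∩ f^[N] ⁻¹' (B : Set ℝ) = A C ∩ f^[N] ⁻¹' (C : Set ℝ) :=
      congrArg Subtype.val hBC
    obtain ⟨x, -, hx⟩ := hne B
    have hx' := hx
    rw [hBC'] at hx'
    exact Subtype.ext (cylinder_eq B.2 C.2 hx.2 hx'.2)
  · obtain ⟨x, hxD, hx⟩ := hne C
    refine le_trans ?_ (le_cylWeight hx)
    simpa using cylWeight_mul_le hf ha hb C.2 N 0 (hf.Ioo_subset (hD hxD)) hx.2

/-- An interval that meets the bounded interval `G` but is not contained in it contains an endpoint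
of `G`. -/
theorem endpoint_mem_of_not_subset {G A : Set ℝ} (hG : G.OrdConnected) (hGa : BddAbove G)
    (hGb : BddBelow G) (hA : A.OrdConnected) (hne : (G ∩ A).Nonempty) (hAG : ¬ A ⊆ G) :
    sInf G ∈ A ∨ sSup G ∈ A := by
  obtain ⟨x, hxG, hxA⟩ := hne
  obtain ⟨y, hyA, hyG⟩ := not_subset.1 hAG
  rcases le_total y x with h | h
  · left
    refine hA.out hyA hxA ⟨le_csInf ⟨x, hxG⟩ fun z hz => ?_, csInf_le hGb hxG⟩
    by_contra! hzy
    exact hyG (hG.out hz hxG ⟨hzy.le, h⟩)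
  · right
    refine hA.out hxA hyA ⟨le_csSup hGa hxG, csSup_le ⟨x, hxG⟩ fun z hz => ?_⟩
    by_contra! hzy
    exact hyG (hG.out hxG hz ⟨h, hzy.le⟩)

/-- All but two of the `R`-cylinders that meet an interval are contained in it; therefore most of
the mass of the partition sum sits on paths that end in one of the finitely many domains
`f^R(C)`. -/
theorem meetSum_add_le (hf : IsPiecewiseMonotone f X) (hb : ∀ x ∈ X, φ x ≤ b) (hD : IsOpen D)
    (hDo : D.OrdConnected) (n R : ℕ) :
    meetSum f φ (n + R) D ≤ 2 * expE (R * b) * meetSum f φ n D +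
      returnSum f φ (n + R) D ((f^[R] '' ·) '' cylinders f R) := by
  set F : Set (Set ℝ) := (f^[R] '' ·) '' cylinders f R with hF
  set S : Set (Set ℝ) := {C | C ∈ cylinders f (n + R) ∧ (D ∩ C).Nonempty} with hS
  set g : Set ℝ → ENNReal := fun C => cylWeight f φ (n + R) C with hg
  have hsplit : meetSum f φ (n + R) D ≤ (∑' C : {C | C ∈ S ∧ f^[n + R] '' (D ∩ C) ∉ F}, g C) +
      returnSum f φ (n + R) D F := by
    have : S ⊆ {C | C ∈ S ∧ f^[n + R] '' (D ∩ C) ∉ F} ∪ {C | C ∈ cylinders f (n + R) ∧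
        (D ∩ C).Nonempty ∧ f^[n + R] '' (D ∩ C) ∈ F} := by
      intro C hC
      by_cases h : f^[n + R] '' (D ∩ C) ∈ F
      · exact Or.inr ⟨hC.1, hC.2, h⟩
      · exact Or.inl ⟨hC, h⟩
    exact (ENNReal.tsum_mono_subtype g this).trans (ENNReal.tsum_union_le g _ _)
  refine hsplit.trans (add_le_add_left ?_ _)
  -- A bad cylinder is `C₁ ∩ f⁻ⁿ A` where `A` meets the interval `fⁿ(D ∩ C₁)` without lying in it.
  -- So `A` contains an endpoint of that interval, and `C₁` together with the choice of the
  -- endpoint, recorded by the `Bool`, determines `A`.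
  have hbad : ∀ C : {C | C ∈ S ∧ f^[n + R] '' (D ∩ C) ∉ F},
      ∃ p : {C // C ∈ cylinders f n ∧ (D ∩ C).Nonempty} × Bool, ∃ A ∈ cylinders f R,
        (C : Set ℝ) = (p.1 : Set ℝ) ∩ f^[n] ⁻¹' A ∧
        (if p.2 then sInf (f^[n] '' (D ∩ p.1)) else sSup (f^[n] '' (D ∩ p.1))) ∈ A := by
    rintro ⟨C, ⟨hC, hne⟩, hCF⟩
    obtain ⟨C₁, hC₁, A, hA, rfl⟩ := exists_concat_eq hf hC
    obtain ⟨x, hxD, hx, hxA⟩ := hne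
    obtain ⟨ho, hoc, hsub⟩ := image_cylinder hf hC₁ hD hDo
    have hnot : ¬ A ⊆ f^[n] '' (D ∩ C₁) := fun h => hCF ⟨A, hA, by
      dsimp only
      rw [image_concat, inter_eq_right.2 h]⟩
    rcases endpoint_mem_of_not_subset hoc ⟨1, fun y hy => (hsub hy).2.le⟩
      ⟨0, fun y hy => (hsub hy).1.le⟩ (cylinder_ordConnected hA)
      ⟨_, ⟨x, ⟨hxD, hx⟩, rfl⟩, hxA⟩ hnot with h | h
    · exact ⟨(⟨C₁, hC₁, x, hxD, hx⟩, true), A, hA, rfl, by simpa using h⟩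
    · exact ⟨(⟨C₁, hC₁, x, hxD, hx⟩, false), A, hA, rfl, by simpa using h⟩
  choose p A hA hCA hmem using hbad
  have hsum : 2 * expE (R * b) * meetSum f φ n D =
      ∑' q : {C // C ∈ cylinders f n ∧ (D ∩ C).Nonempty} × Bool,
        cylWeight f φ n q.1 * expE (R * b) := by
    rw [ENNReal.tsum_prod (f := fun (C : {C // C ∈ cylinders f n ∧ (D ∩ C).Nonempty}) (_ : Bool) =>
      cylWeight f φ n C * expE (R * b))]
    simp only [tsum_fintype, Fintype.sum_bool]
    rw [meetSum, ← ENNReal.tsum_mul_left]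
    exact tsum_congr fun C => by ring
  rw [hsum]
  refine tsum_le_tsum_of_injective p (fun B C hBC => Subtype.ext ?_) fun C => ?_
  · have h1 := hmem B
    have h2 := hmem C
    rw [← hBC] at h2
    rw [hCA B, hCA C, hBC, cylinder_eq (hA B) (hA C) h1 h2]
  · rw [hg]
    dsimp only
    rw [hCA C]
    exact (cylWeight_concat_le _ _).trans (mul_le_mul_right (cylWeight_le hf hb (hA C)) _)

/-- Lower bound for the sum over periodic points, by closing up paths that return to `F`. -/
theorem le_hatZ (hf : IsPiecewiseMonotone f X) (ha : ∀ x ∈ X, a ≤ φ x)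
    (hb : ∀ x ∈ X, φ x ≤ b) {F : Set (Set ℝ)} {K l : ℕ} (hD : D ⊆ Ioo 0 1) {A : Set ℝ}
    (hA : A ∈ cylinders f K) {u v : ℝ} (hAuv : A ⊆ Icc u v) (huv : Icc u v ⊆ D ∩ C)
    (hu : u ≤ v)
    (hF : ∀ n, ∀ B ∈ cylinders f n, (f^[K] '' A ∩ B).Nonempty → f^[n] '' (f^[K] '' A ∩ B) ∈ F →
      ∃ T ∈ cylinders f l, (f^[n] '' (f^[K] '' A ∩ B) ∩ T).Nonempty ∧
        f^[l] '' (f^[n] '' (f^[K] '' A ∩ B) ∩ T) = D) (n : ℕ) :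
    expE (((K + l : ℕ) : ℝ) * a - beta f φ n) * returnSum f φ n (f^[K] '' A) F ≤
      hatZ f φ ((D ∩ C) ×ˢ {D}) (K + n + l) := by
  rw [returnSum, ← ENNReal.tsum_mul_left]
  have hAD : A ⊆ D := fun x hx => (huv (hAuv hx)).1
  have h : ∀ B : {B // B ∈ cylinders f n ∧ (f^[K] '' A ∩ B).Nonempty ∧
      f^[n] '' (f^[K] '' A ∩ B) ∈ F}, ∃ x ∈ A, f^[K] x ∈ (B : Set ℝ) ∧
        (hatMap f)^[K + n + l] (x, D) = (x, D) := by
    rintro ⟨B, hB, hne, hBF⟩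
    obtain ⟨T, hT, ⟨_, ⟨_, ⟨⟨z, hz, rfl⟩, hzB⟩, rfl⟩, hzT⟩, himg⟩ := hF n B hB hne hBF
    have hAB := concat_mem_cylinders hf hA hB ⟨z, hz, hzB⟩
    have hzT' : f^[K + n] z ∈ T := by rwa [add_comm, Function.iterate_add_apply]
    have hABT := concat_mem_cylinders hf hAB hT ⟨z, ⟨hz, hzB⟩, hzT'⟩
    set W := A ∩ f^[K] ⁻¹' B ∩ f^[K + n] ⁻¹' T with hW
    -- The image is exactly `D`, so the fixed point found below returns to its own level of the
    -- tower.
    have hDW : f^[K + n + l] '' (D ∩ W) = D := by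
      rw [hW, image_concat, image_concat, inter_eq_right.2 hAD, himg]
    have hWD : W ⊆ D := fun x hx => hAD hx.1.1
    have hc := cylinder_continuousOn hABT le_rfl
    have hfix : ∃ x ∈ W, f^[K + n + l] x = x := by
      have hu' : u ∈ f^[K + n + l] '' (D ∩ W) := hDW.symm ▸ (huv (left_mem_Icc.2 hu)).1
      have hv' : v ∈ f^[K + n + l] '' (D ∩ W) := hDW.symm ▸ (huv (right_mem_Icc.2 hu)).1
      obtain ⟨s, hs, hsu⟩ := hu'
      obtain ⟨t, ht, htv⟩ := hv'
      -- The points `s, t` of `W ⊆ [u, v]` are sent to `u` and `v`, so the graph is below the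
      -- diagonal at `s` and above it at `t`.
      exact (cylinder_ordConnected hABT).isPreconnected.intermediate_value₂ hs.2 ht.2 hc
        continuousOn_id (hsu.trans_le (hAuv hs.2.1.1).1) ((hAuv ht.2.1.1).2.trans htv.ge)
    obtain ⟨x, hx, hfx⟩ := hfix
    refine ⟨x, hx.1.1, hx.1.2, ?_⟩
    rw [hatMap_iterate_of_mem hABT hx hD, hfx, hDW]
  choose x hxA hxB hx using h
  refine tsum_le_tsum_of_injective (fun B => ⟨(x B, D), ⟨huv (hAuv (hxA B)), rfl⟩, hx B⟩)
    (fun B B' hBB => ?_) fun B => ?_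
  · have : x B = x B' := congrArg (fun p => p.1.1) hBB
    exact Subtype.ext (cylinder_eq B.2.1 B'.2.1 (hxB B) (this ▸ hxB B'))
  · rw [birkhoffSum_hatMap]
    exact cylWeight_mul_le hf ha hb B.2.1 K l (hf.Ioo_subset (hD (hAD (hxA B)))) (hxB B)

end estimates

/-! ### Exponential growth rates -/

theorem log_expE_mul_div {n : ℕ} (hn : n ≠ 0) (r : ℝ) :
    ENNReal.log (expE (n * r)) / (n : EReal) = (r : EReal) := by
  have hn' : (n : ℝ) ≠ 0 := Nat.cast_ne_zero.2 hn
  rw [log_expE, ← EReal.coe_coe_eq_natCast, ← EReal.coe_div, mul_div_cancel_left₀ _ hn']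

theorem le_log_div {n : ℕ} (hn : n ≠ 0) {r : ℝ} {s : ENNReal} (h : expE (n * r) ≤ s) :
    (r : EReal) ≤ ENNReal.log s / (n : EReal) := by
  rw [← log_expE_mul_div hn r]
  exact EReal.div_le_div_right_of_nonneg (Nat.cast_nonneg' n) (ENNReal.log_monotone h)

theorem log_div_le {n : ℕ} (hn : n ≠ 0) {r : ℝ} {s : ENNReal} (h : s ≤ expE (n * r)) :
    ENNReal.log s / (n : EReal) ≤ (r : EReal) := by
  rw [← log_expE_mul_div hn r]
  exact EReal.div_le_div_right_of_nonneg (Nat.cast_nonneg' n) (ENNReal.log_monotone h)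

theorem tendsto_log_div {s : ℕ → ENNReal} {P : ℝ}
    (h₁ : ∀ ε > 0, ∀ᶠ n : ℕ in atTop, expE (n * (P - ε)) ≤ s n)
    (h₂ : ∀ ε > 0, ∀ᶠ n : ℕ in atTop, s n ≤ expE (n * (P + ε))) :
    Tendsto (fun n : ℕ => ENNReal.log (s n) / n) atTop (𝓝 (P : EReal)) := by
  rw [tendsto_order]
  constructor
  · intro c hc
    obtain ⟨r, hcr, hr⟩ := EReal.lt_iff_exists_real_btwn.1 hc
    have hr' : r < P := EReal.coe_lt_coe_iff.1 hr
    filter_upwards [h₁ (P - r) (by linarith), eventually_ne_atTop 0] with n hn h0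
    rw [sub_sub_cancel] at hn
    exact hcr.trans_le (le_log_div h0 hn)
  · intro c hc
    obtain ⟨r, hr, hcr⟩ := EReal.lt_iff_exists_real_btwn.1 hc
    have hr' : P < r := EReal.coe_lt_coe_iff.1 hr
    filter_upwards [h₂ (r - P) (by linarith), eventually_ne_atTop 0] with n hn h0
    rw [add_sub_cancel] at hn
    exact (log_div_le h0 hn).trans_lt hcr

/-- The lower bound is asked for only infinitely often: this is all that closing up paths provides.
-/
theorem limsup_log_div_eq {s : ℕ → ENNReal} {P : ℝ}
    (h₁ : ∀ ε > 0, ∃ᶠ n : ℕ in atTop, expE (n * (P - ε)) ≤ s n)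
    (h₂ : ∀ ε > 0, ∀ᶠ n : ℕ in atTop, s n ≤ expE (n * (P + ε))) :
    limsup (fun n : ℕ => ENNReal.log (s n) / n) atTop = (P : EReal) := by
  apply le_antisymm
  · refine le_of_forall_gt fun c hc => ?_
    obtain ⟨r, hr, hcr⟩ := EReal.lt_iff_exists_real_btwn.1 hc
    have hr' : P < r := EReal.coe_lt_coe_iff.1 hr
    refine lt_of_le_of_lt (limsup_le_of_le (by isBoundedDefault) ?_) hcr
    filter_upwards [h₂ (r - P) (by linarith), eventually_ne_atTop 0] with n hn h0
    rw [add_sub_cancel] at hn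
    exact log_div_le h0 hn
  · refine le_of_forall_lt fun c hc => ?_
    obtain ⟨r, hcr, hr⟩ := EReal.lt_iff_exists_real_btwn.1 hc
    have hr' : r < P := EReal.coe_lt_coe_iff.1 hr
    refine lt_of_lt_of_le hcr (le_limsup_of_frequently_le ?_ (by isBoundedDefault))
    refine ((h₁ (P - r) (by linarith)).and_eventually (eventually_ne_atTop 0)).mono ?_
    rintro n ⟨hn, h0⟩
    rw [sub_sub_cancel] at hn
    exact le_log_div h0 hn

/-- Constants, subexponential factors and shifts of time do not affect exponential growth. -/
theorem eventually_expE_le {β : ℕ → ℝ} (hβ : β =o[atTop] fun n : ℕ => (n : ℝ)) (P c : ℝ) (k : ℕ)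
    {ε : ℝ} (hε : 0 < ε) : ∀ᶠ m : ℕ in atTop,
      expE (((k + m : ℕ) : ℝ) * (P - ε)) ≤ expE (c - β m) * expE (m * (P - ε / 3)) := by
  -- One third of `ε` pays for `β`, one third for the constant and the shift; the last third is left
  -- in the growth of the sum.
  have h1 := hβ.bound (show 0 < ε / 3 by positivity)
  have h2 : ∀ᶠ m : ℕ in atTop, (k * (P - ε) - c) / (ε / 3) ≤ m :=
    tendsto_natCast_atTop_atTop.eventually_ge_atTop _
  filter_upwards [h1, h2] with m h1 h2
  rw [← expE_add]
  apply expE_mono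
  rw [Real.norm_eq_abs, Real.norm_eq_abs, abs_of_nonneg (a := (m : ℝ)) (Nat.cast_nonneg m)] at h1
  rw [div_le_iff₀ (by positivity)] at h2
  have h3 := le_abs_self (β m)
  push_cast
  linarith

theorem lowerGrowth_shift {β : ℕ → ℝ} (hβ : β =o[atTop] fun n : ℕ => (n : ℝ)) {P c : ℝ} {k : ℕ}
    {s t : ℕ → ENNReal} (ht : ∀ ε > 0, ∀ᶠ n : ℕ in atTop, expE (n * (P - ε)) ≤ t n)
    (h : ∀ m, expE (c - β m) * t m ≤ s (k + m)) :
    ∀ ε > 0, ∀ᶠ n : ℕ in atTop, expE (n * (P - ε)) ≤ s n := by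
  intro ε hε
  have : ∀ᶠ m : ℕ in atTop, expE (((m + k : ℕ) : ℝ) * (P - ε)) ≤ s (m + k) := by
    filter_upwards [eventually_expE_le hβ P c k hε, ht (ε / 3) (by positivity)] with m h1 h2
    rw [add_comm m k]
    exact h1.trans ((mul_le_mul_right h2 _).trans (h m))
  exact (eventually_map.2 this).filter_mono (map_add_atTop_eq_nat k).ge

theorem exists_le_expE {x : ENNReal} (hx : x ≠ ⊤) : ∃ r, x ≤ expE r := by
  refine ⟨Real.log (x.toReal + 1), ?_⟩
  rw [expE, Real.exp_log (by positivity), ← ENNReal.ofReal_toReal hx]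
  apply ENNReal.ofReal_le_ofReal
  rw [ENNReal.toReal_ofReal ENNReal.toReal_nonneg]
  linarith

/-! ### Pressure of the base and of the tower -/

section pressure

variable {f φ : ℝ → ℝ} {X C C' D D' : Set ℝ} {E : Set (Set ℝ)} {n m k : ℕ} {x : ℝ} {a b P : ℝ}

theorem exists_pressure (hf : IsPiecewiseMonotone f X) (ha : ∀ x ∈ X, a ≤ φ x)
    (hb : ∀ x ∈ X, φ x ≤ b) : ∃ P : ℝ,
      (∀ ε > 0, ∀ᶠ n : ℕ in atTop, expE (n * (P - ε)) ≤ topSum f φ n) ∧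
      (∀ ε > 0, ∀ᶠ n : ℕ in atTop, topSum f φ n ≤ expE (n * (P + ε))) := by
  set u : ℕ → ℝ := fun n => Real.log (topSum f φ n).toReal with hu
  have hpos : ∀ n, 0 < (topSum f φ n).toReal := fun n =>
    ENNReal.toReal_pos (fun h => expE_ne_zero (n * a)
      (le_antisymm (h ▸ expE_le_topSum hf ha n) zero_le)) (topSum_ne_top hf hb n)
  have hexp : ∀ n, expE (u n) = topSum f φ n := fun n => by
    rw [expE, hu, Real.exp_log (hpos n), ENNReal.ofReal_toReal (topSum_ne_top hf hb n)]
  have hsub : Subadditive u := by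
    intro n m
    rw [hu]
    dsimp only
    rw [← Real.log_mul (hpos n).ne' (hpos m).ne', ← ENNReal.toReal_mul]
    exact Real.log_le_log (hpos _) (ENNReal.toReal_mono
      (ENNReal.mul_ne_top (topSum_ne_top hf hb n) (topSum_ne_top hf hb m)) (topSum_add_le hf n m))
  have hlow : ∀ n : ℕ, n * a ≤ u n := fun n => by
    rw [hu]
    dsimp only
    rw [Real.le_log_iff_exp_le (hpos n)]
    have := ENNReal.toReal_mono (topSum_ne_top hf hb n) (expE_le_topSum hf ha n)
    rwa [expE, ENNReal.toReal_ofReal (Real.exp_pos _).le] at this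
  have hbdd : BddBelow (range fun n => u n / n) := by
    -- The `0` covers the quotient at `n = 0`, which is `0` by convention.
    refine ⟨min a 0, ?_⟩
    rintro _ ⟨n, rfl⟩
    rcases Nat.eq_zero_or_pos n with rfl | hn
    · simp
    · refine (min_le_left _ _).trans ?_
      dsimp only
      rw [le_div_iff₀ (by positivity)]
      linarith [hlow n]
  have hlim := hsub.tendsto_lim hbdd
  refine ⟨hsub.lim, fun ε hε => ?_, fun ε hε => ?_⟩
  · filter_upwards [hlim.eventually_const_lt (show hsub.lim - ε < hsub.lim by linarith),
      eventually_gt_atTop 0] with n hn h0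
    rw [← hexp]
    rw [lt_div_iff₀ (by positivity)] at hn
    exact expE_mono (by linarith)
  · filter_upwards [hlim.eventually_lt_const (show hsub.lim < hsub.lim + ε by linarith),
      eventually_gt_atTop 0] with n hn h0
    rw [← hexp]
    rw [div_lt_iff₀ (by positivity)] at hn
    exact expE_mono (by linarith)

/-- If the pressure exceeds `sup φ`, the number of cylinders is unbounded. -/
theorem exists_three_le_ncard (hf : IsPiecewiseMonotone f X) (hb : ∀ x ∈ X, φ x ≤ b)
    (hP : ∀ ε > 0, ∀ᶠ n : ℕ in atTop, expE (n * (P - ε)) ≤ topSum f φ n) (hbP : b < P) :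
    ∃ m, 2 < (cylinders f m).ncard := by
  have h2 : ∀ᶠ m : ℕ in atTop, 2 / ((P - b) / 2) ≤ m :=
    tendsto_natCast_atTop_atTop.eventually_ge_atTop _
  -- The second condition makes the exponent `m (P - b) / 2` at least `2`, so that `exp` of it is at
  -- least `3`.
  obtain ⟨m, hm, hm2⟩ := ((hP ((P - b) / 2) (by linarith)).and h2).exists
  refine ⟨m, ?_⟩
  rw [div_le_iff₀ (by linarith)] at hm2
  have h3 := hm.trans (topSum_le hf hb m)
  rw [show (m : ℝ) * (P - (P - b) / 2) = m * ((P - b) / 2) + m * b by ring, expE_add,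
    ENNReal.mul_le_mul_iff_left (expE_ne_zero _) (expE_ne_top _)] at h3
  have h4 : ENNReal.ofReal 3 ≤ (cylinders f m).ncard := by
    refine le_trans (ENNReal.ofReal_le_ofReal ?_) h3
    have := Real.add_one_le_exp (m * ((P - b) / 2))
    linarith
  rw [ENNReal.ofReal_ofNat] at h4
  have : 3 ≤ (cylinders f m).ncard := by exact_mod_cast h4
  omega

/-- Partition sums are carried by paths that return to a finite set of domains. -/
theorem exists_frequently_meetSum_le (hf : IsPiecewiseMonotone f X) (hb : ∀ x ∈ X, φ x ≤ b)
    (hD : IsOpen D) (hDo : D.OrdConnected)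
    (hP : ∀ ε > 0, ∀ᶠ n : ℕ in atTop, expE (n * (P - ε)) ≤ meetSum f φ n D) (hbP : b < P) :
    ∃ R : ℕ, ∃ᶠ n in atTop,
      meetSum f φ n D ≤ 2 * returnSum f φ n D ((f^[R] '' ·) '' cylinders f R) := by
  set δ := P - b with hδ
  have hδ0 : 0 < δ := by linarith
  have hfin : ∀ n, meetSum f φ n D ≠ ⊤ := fun n =>
    ((meetSum_le_topSum f φ n D).trans_lt (topSum_ne_top hf hb n).lt_top).ne
  -- If bad paths carried more than half of the mass at all late times, each block of `R` steps
  -- would multiply the sum by at most `4 exp(Rb)`. This `R` brings the factor below `exp(R(b +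
  -- δ/2))`, a rate smaller than `P`.
  obtain ⟨R, hR⟩ := exists_nat_ge (Real.log 4 / (δ / 2))
  rw [div_le_iff₀ (by positivity)] at hR
  have hRpos : 0 < (R : ℝ) := by
    by_contra! h
    have := Real.log_pos (show (1 : ℝ) < 4 by norm_num)
    nlinarith
  refine ⟨R, fun hev => ?_⟩
  obtain ⟨n₀, hn₀⟩ := eventually_atTop.1 (hev.and (hP (δ / 4) (by positivity)))
  have hfour : (4 : ENNReal) * expE (R * b) ≤ expE (R * (b + δ / 2)) := by
    rw [mul_add, add_comm, expE_add]
    refine mul_le_mul_left ?_ _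
    rw [← ENNReal.ofReal_ofNat, expE]
    refine ENNReal.ofReal_le_ofReal ?_
    rwa [← Real.log_le_iff_le_exp (by norm_num)]
  have hstep : ∀ n ≥ n₀, meetSum f φ (n + R) D ≤ expE (R * (b + δ / 2)) * meetSum f φ n D := by
    intro n hn
    refine le_trans ?_ (mul_le_mul_left hfour _)
    have h1 := meetSum_add_le hf hb hD hDo n R
    have h2 := (not_le.1 (hn₀ (n + R) (by omega)).1).le
    have h3 : meetSum f φ (n + R) D + meetSum f φ (n + R) D ≤
        4 * expE (R * b) * meetSum f φ n D + meetSum f φ (n + R) D := by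
      calc meetSum f φ (n + R) D + meetSum f φ (n + R) D
          = 2 * meetSum f φ (n + R) D := (two_mul _).symm
        _ ≤ 2 * (2 * expE (R * b) * meetSum f φ n D +
              returnSum f φ (n + R) D ((f^[R] '' ·) '' cylinders f R)) := mul_le_mul_right h1 _
        _ = 4 * expE (R * b) * meetSum f φ n D +
              2 * returnSum f φ (n + R) D ((f^[R] '' ·) '' cylinders f R) := by ring
        _ ≤ _ := add_le_add_right h2 _
    exact (ENNReal.add_le_add_iff_right (hfin _)).1 h3
  have hiter : ∀ j : ℕ, meetSum f φ (n₀ + j * R) D ≤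
      expE (j * (R * (b + δ / 2))) * meetSum f φ n₀ D := by
    intro j
    induction j with
    | zero => simp [expE_zero]
    | succ j ih =>
      rw [show n₀ + (j + 1) * R = n₀ + j * R + R by ring]
      refine (hstep _ (by omega)).trans ((mul_le_mul_right ih _).trans (le_of_eq ?_))
      rw [← mul_assoc, ← expE_add]
      congr 2
      push_cast
      ring
  obtain ⟨r, hr⟩ := exists_le_expE (hfin n₀)
  obtain ⟨j, hj⟩ := exists_nat_gt ((r - n₀ * (P - δ / 4)) / (R * (δ / 4)))
  rw [div_lt_iff₀ (by positivity)] at hj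
  have h1 := ((hn₀ (n₀ + j * R) (by omega)).2.trans (hiter j)).trans (mul_le_mul_right hr _)
  rw [← expE_add, expE, expE, ENNReal.ofReal_le_ofReal_iff (Real.exp_pos _).le,
    Real.exp_le_exp] at h1
  push_cast at h1
  have : P = b + δ := by rw [hδ]; ring
  rw [this] at h1 hj
  nlinarith

/-- An open interval that is eventually mapped over `(0,1)` contains cylinders compactly. -/
theorem exists_inner_cylinder (hf : IsPiecewiseMonotone f X) {N : ℕ} (hDo : D.OrdConnected)
    (hD : D ⊆ Ioo 0 1) (hN : Ioo 0 1 ⊆ f^[N] '' D) (hm : 2 < (cylinders f m).ncard) :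
    ∃ K, ∃ A ∈ cylinders f K, ∃ u v, u ≤ v ∧ A ⊆ Icc u v ∧ Icc u v ⊆ D := by
  have h : ∀ C : cylinders f m, ∃ A ∈ cylinders f N,
      (D ∩ (A ∩ f^[N] ⁻¹' (C : Set ℝ))).Nonempty :=
    fun C => exists_cylinder_of_cover hf hD hN C.2
  choose A hA hne using h
  choose x hxD hx using hne
  have hcyl : ∀ C, A C ∩ f^[N] ⁻¹' (C : Set ℝ) ∈ cylinders f (N + m) := fun C =>
    concat_mem_cylinders hf (hA C) C.2 ⟨x C, hx C⟩
  have huniq : ∀ B C : cylinders f m, x B ∈ A C ∩ f^[N] ⁻¹' (C : Set ℝ) → x B = x C := by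
    intro B C h
    have : B = C := Subtype.ext (cylinder_eq B.2 C.2 (hx B).2 h.2)
    rw [this]
  -- Of three disjoint cylinders meeting `D`, the middle one lies between points of the outer two,
  -- hence compactly inside `D`.
  have key : ∀ B C B' : cylinders f m, x B < x C → x C < x B' →
      ∃ K, ∃ A ∈ cylinders f K, ∃ u v, u ≤ v ∧ A ⊆ Icc u v ∧ Icc u v ⊆ D := by
    intro B C B' h1 h2
    refine ⟨_, _, hcyl C, x B, x B', (h1.trans h2).le, fun y hy => ⟨?_, ?_⟩,
      hDo.out (hxD B) (hxD B')⟩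
    · by_contra! hyB
      exact h1.ne (huniq B C ((cylinder_ordConnected (hcyl C)).out hy (hx C) ⟨hyB.le, h1.le⟩))
    · by_contra! hyB
      exact h2.ne' (huniq B' C ((cylinder_ordConnected (hcyl C)).out (hx C) hy ⟨h2.le, hyB.le⟩))
  have hinj : ∀ B C : cylinders f m, x B = x C → B = C := fun B C h =>
    Subtype.ext (cylinder_eq B.2 C.2 (hx B).2 (h ▸ (hx C).2))
  obtain ⟨B₁, B₂, B₃, h₁, h₂, h₃, h12, h13, h23⟩ :=
    (two_lt_ncard_iff (cylinders_finite hf m)).1 hm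
  have h12 : x ⟨B₁, h₁⟩ ≠ x ⟨B₂, h₂⟩ := fun h => h12 (Subtype.mk.inj (hinj _ _ h))
  have h13 : x ⟨B₁, h₁⟩ ≠ x ⟨B₃, h₃⟩ := fun h => h13 (Subtype.mk.inj (hinj _ _ h))
  have h23 : x ⟨B₂, h₂⟩ ≠ x ⟨B₃, h₃⟩ := fun h => h23 (Subtype.mk.inj (hinj _ _ h))
  rcases h12.lt_or_gt with h | h <;> rcases h13.lt_or_gt with h' | h' <;>
    rcases h23.lt_or_gt with h'' | h''
  · exact key _ _ _ h h''
  · exact key _ _ _ h' h''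
  · exact absurd (h.trans h'') h'.not_gt
  · exact key _ _ _ h' h
  · exact key _ _ _ h h'
  · exact absurd (h''.trans h) h'.not_gt
  · exact key _ _ _ h'' h'
  · exact key _ _ _ h'' h

theorem hat_pressures (hf : IsPiecewiseMonotone f X) (ha : ∀ x ∈ X, a ≤ φ x)
    (hb : ∀ x ∈ X, φ x ≤ b) (hβ : (fun n : ℕ => beta f φ n) =o[atTop] fun n : ℕ => (n : ℝ))
    (hP₁ : ∀ ε > 0, ∀ᶠ n : ℕ in atTop, expE (n * (P - ε)) ≤ topSum f φ n)
    (hP₂ : ∀ ε > 0, ∀ᶠ n : ℕ in atTop, topSum f φ n ≤ expE (n * (P + ε))) (hbP : b < P)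
    (hE : IsTransitivePart f E) {Chat : Set (ℝ × Set ℝ)} (hChat : Chat ∈ hatCylinders f E k) :
    Tendsto (fun n : ℕ => ENNReal.log (hatTopSum f φ Chat n) / n) atTop (𝓝 (P : EReal)) ∧
      hatGurevich f φ Chat = (P : EReal) := by
  obtain ⟨D, hD, C, hC, hne, rfl⟩ := hChat
  have hmeet : ∀ G ∈ E, ∀ ε > 0, ∀ᶠ n : ℕ in atTop, expE (n * (P - ε)) ≤ meetSum f φ n G := by
    intro G hG
    obtain ⟨N, hN⟩ := hE.exists_cover hf hG
    exact lowerGrowth_shift hβ hP₁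
      (le_meetSum hf ha hb (domain_props hf (hE.subset hG)).2.2.2 hN)
  obtain ⟨hDop, hDoc, -, hDsub⟩ := domain_props hf (hE.subset hD)
  have hD₁ := hE.image_mem hf hD hC hne
  constructor
  · exact tendsto_log_div
      (lowerGrowth_shift hβ (hmeet _ hD₁) (le_hatTopSum hf ha hb (hE.subset hD) hC))
      fun ε hε => (hP₂ ε hε).mono fun n hn => (hatTopSum_le_topSum D C n).trans hn
  · refine limsup_log_div_eq (fun ε hε => ?_) fun ε hε => ?_
    swap
    · filter_upwards [hP₂ ε hε, eventually_ge_atTop 1] with n hn h1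
      exact (hatZ_le_topSum hf hDsub h1).trans hn
    obtain ⟨N, hN⟩ := hE.exists_cover hf hD₁
    rw [← image_comp, ← Function.iterate_add] at hN
    obtain ⟨m, hm⟩ := exists_three_le_ncard hf hb hP₁ hbP
    obtain ⟨K, A, hA, u, v, huv, hAuv, huvD⟩ := exists_inner_cylinder hf
      (hDoc.inter (cylinder_ordConnected hC)) (inter_subset_left.trans hDsub) hN hm
    have hAD : A ⊆ D := fun x hx => (huvD (hAuv hx)).1
    have hA₁ : f^[K] '' A ∈ E := by
      have := hE.image_mem hf hD hA (by rw [inter_eq_right.2 hAD]; exact hA.1)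
      rwa [inter_eq_right.2 hAD] at this
    obtain ⟨hAop, hAoc, -, -⟩ := domain_props hf (hE.subset hA₁)
    obtain ⟨R, hR⟩ := exists_frequently_meetSum_le hf hb hAop hAoc (hmeet _ hA₁) hbP
    set F : Set (Set ℝ) := (f^[R] '' ·) '' cylinders f R with hF
    have hFfin : F.Finite := (cylinders_finite hf R).image _
    -- Finiteness of `F` turns primitivity into one return time `l` valid for all its members in
    -- `E`.
    have hpath : ∀ᶠ l in atTop, ∀ G ∈ F ∩ E, HasPath f l G D :=
      ((hFfin.subset inter_subset_left).eventually_all).2 fun G hG => hE.primitive G hG.2 D hD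
    obtain ⟨l, hl⟩ := hpath.exists
    have hZ := le_hatZ (φ := φ) (F := F) (l := l) hf ha hb hDsub hA hAuv huvD huv
      fun n B hB hne hBF => (hl _ ⟨hBF, hE.image_mem hf hA₁ hB hne⟩).exists_cylinder hf
        (hE.subset (hE.image_mem hf hA₁ hB hne))
    -- The `log 2` absorbs the loss of half of the mass.
    have hev := eventually_expE_le hβ P (((K + l : ℕ) : ℝ) * a - Real.log 2) (K + l) hε
    have hfreq := hR.and_eventually (hev.and (hmeet _ hA₁ (ε / 3) (by positivity)))
    have htwo : expE (-Real.log 2) * 2 = 1 := by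
      have : (2 : ENNReal) = expE (Real.log 2) := by
        rw [expE, Real.exp_log two_pos, ENNReal.ofReal_ofNat]
      rw [this, ← expE_add, neg_add_cancel, expE_zero]
    refine (tendsto_add_atTop_nat (K + l)).frequently (hfreq.mono ?_)
    rintro n ⟨h1, h2, h3⟩
    rw [show n + (K + l) = K + n + l by omega]
    rw [show K + l + n = K + n + l by omega] at h2
    calc expE (((K + n + l : ℕ) : ℝ) * (P - ε))
        ≤ expE (((K + l : ℕ) : ℝ) * a - Real.log 2 - beta f φ n) * expE (n * (P - ε / 3)) := h2
      _ ≤ expE (((K + l : ℕ) : ℝ) * a - Real.log 2 - beta f φ n) *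
            (2 * returnSum f φ n (f^[K] '' A) F) := mul_le_mul_right (h3.trans h1) _
      _ = expE (((K + l : ℕ) : ℝ) * a - beta f φ n) * returnSum f φ n (f^[K] '' A) F := by
          rw [show ((K + l : ℕ) : ℝ) * a - Real.log 2 - beta f φ n =
            (((K + l : ℕ) : ℝ) * a - beta f φ n) + -Real.log 2 by ring, expE_add, mul_assoc,
            ← mul_assoc (expE (-Real.log 2)), htwo, one_mul]
      _ ≤ _ := hZ n

end pressure

/-! ### Topological entropy is bounded by the growth of the number of cylinders -/

section entropy

variable {f : ℝ → ℝ} {X C : Set ℝ} {n M : ℕ}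

open Classical in
/-- An integer that records, up to the orientation of the iterates on `C`, in which intervals of
length `1 / M` the first `n` points of the orbit of `x` lie. -/
def orbitCode (f : ℝ → ℝ) (M n : ℕ) (C : Set ℝ) (x : ℝ) : ℤ :=
  ∑ i ∈ Finset.range n, (if StrictMonoOn f^[i] C then ⌊M * f^[i] x⌋ else -⌊M * f^[i] x⌋)

theorem orbitCode_mem (hf : IsPiecewiseMonotone f X) {x : ℝ} (hx : x ∈ X) (C : Set ℝ) :
    orbitCode f M n C x ∈ Icc (-(n * M : ℤ)) (n * M) := by
  have h : ∀ i, 0 ≤ ⌊M * f^[i] x⌋ ∧ ⌊M * f^[i] x⌋ ≤ M := by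
    intro i
    have hi := hf.subset_Icc (mapsTo_iterate hf i hx)
    have hM : (0 : ℝ) ≤ M := Nat.cast_nonneg M
    refine ⟨Int.floor_nonneg.2 (mul_nonneg hM hi.1), ?_⟩
    refine Int.floor_le_iff.2 ?_
    push_cast
    nlinarith [hi.2]
  have h1 := Finset.card_nsmul_le_sum (Finset.range n) (fun i =>
    open Classical in if StrictMonoOn f^[i] C then ⌊M * f^[i] x⌋ else -⌊M * f^[i] x⌋) (-(M : ℤ))
    (fun i _ => by have := h i; split_ifs <;> linarith)
  have h2 := Finset.sum_le_card_nsmul (Finset.range n) (fun i =>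
    open Classical in if StrictMonoOn f^[i] C then ⌊M * f^[i] x⌋ else -⌊M * f^[i] x⌋) (M : ℤ)
    (fun i _ => by have := h i; split_ifs <;> linarith)
  simp only [Finset.card_range, nsmul_eq_mul] at h1 h2
  exact ⟨by rw [orbitCode]; linarith, by rw [orbitCode]; linarith⟩

/-- With the signs chosen by orientation every term of the code is nondecreasing in the point of
`C`. Equal sums therefore force equal terms, so a single integer of size `O(nM)` records the whole
discretised orbit. -/
theorem abs_sub_le_of_orbitCode_eq (hM : 0 < M) (hC : C ∈ cylinders f n) {x y : ℝ} (hx : x ∈ C)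
    (hy : y ∈ C) (h : orbitCode f M n C x = orbitCode f M n C y) {i : ℕ} (hi : i < n) :
    |f^[i] x - f^[i] y| ≤ 1 / M := by
  wlog hxy : x ≤ y generalizing x y
  · rw [abs_sub_comm]
    exact this hy hx h.symm (le_of_not_ge hxy)
  have hterm := (Finset.sum_eq_sum_iff_of_le fun i hi => by
    have hM' : (0 : ℝ) ≤ M := Nat.cast_nonneg M
    have hi := Finset.mem_range.1 hi
    split_ifs with hs
    · exact Int.floor_le_floor (mul_le_mul_of_nonneg_left (hs.monotoneOn hx hy hxy) hM')
    · have hs' := (cylinder_strict hC hi.le).resolve_left hs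
      exact neg_le_neg (Int.floor_le_floor
        (mul_le_mul_of_nonneg_left (hs'.antitoneOn hx hy hxy) hM'))).1 h i (Finset.mem_range.2 hi)
  have hfl : ⌊M * f^[i] x⌋ = ⌊M * f^[i] y⌋ := by
    split_ifs at hterm with hs
    exacts [hterm, neg_injective hterm]
  have hM' : (0 : ℝ) < M := Nat.cast_pos.2 hM
  have := Int.abs_sub_lt_one_of_floor_eq_floor hfl
  rw [← mul_sub, abs_mul, abs_of_pos hM'] at this
  rw [le_div_iff₀ hM']
  linarith

/-- Spanning sets of controlled cardinality. -/
theorem exists_isDynCoverOf {Y : Type*} [PseudoMetricSpace Y] {T : Y → Y} {F : Set Y} {π : ℝ → Y}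
    (hf : IsPiecewiseMonotone f X) (hF : IsClosed F) (hT : ContinuousOn T F) (hTF : MapsTo T F F)
    (hπ : MapsTo π X F) (hsemi : ∀ x ∈ X, T (π x) = π (f x))
    (hdist : ∀ x y, dist (π x) (π y) ≤ |x - y|)
    (hdense : ∀ S : Set ℝ, S.Finite → F ⊆ closure (π '' (Ioo 0 1 \ S)))
    {U : SetRel Y Y} (hM : 0 < M) (hU : ∀ x y : Y, dist x y ≤ 1 / M → (x, y) ∈ U) (n : ℕ) :
    ∃ s : Finset Y, Dynamics.IsDynCoverOf T F U n s ∧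
      s.card ≤ (cylinders f n).ncard * (2 * n * M + 1) := by
  classical
  have hiter : ∀ i, ∀ x ∈ X, T^[i] (π x) = π (f^[i] x) := by
    intro i
    induction i with
    | zero => simp
    | succ i ih =>
      intro x hx
      rw [Function.iterate_succ_apply', ih x hx, hsemi _ (mapsTo_iterate hf i hx),
        Function.iterate_succ_apply']
  -- A representative for each pair of cylinder and code. The value `0` for pairs that do not occur
  -- merely adds a harmless extra centre.
  set r : Set ℝ × ℤ → ℝ := fun q =>
    if h : ∃ x ∈ q.1, orbitCode f M n q.1 x = q.2 then h.choose else 0 with hr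
  have hrspec : ∀ (C : Set ℝ), ∀ x ∈ C,
      r (C, orbitCode f M n C x) ∈ C ∧
        orbitCode f M n C (r (C, orbitCode f M n C x)) = orbitCode f M n C x := by
    intro C x hx
    have h : ∃ y ∈ C, orbitCode f M n C y = orbitCode f M n C x := ⟨x, hx, rfl⟩
    rw [hr]
    simp only [dif_pos h]
    exact h.choose_spec
  have hfin := cylinders_finite hf n
  set s : Finset Y := (hfin.toFinset ×ˢ Finset.Icc (-(n * M : ℤ)) (n * M)).image
    (fun q => π (r q)) with hs
  refine ⟨s, ?_, ?_⟩
  swap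
  · refine Finset.card_image_le.trans ?_
    rw [Finset.card_product, ← ncard_eq_toFinset_card _ hfin, Int.card_Icc]
    refine Nat.mul_le_mul_left _ (le_of_eq ?_)
    have : (n * M : ℤ) + 1 - -(n * M) = ((2 * n * M + 1 : ℕ) : ℤ) := by push_cast; ring
    rw [this, Int.toNat_natCast]
  -- The points close to a chosen orbit form a closed set. It contains all orbits that stay in the
  -- branches, and the finitely many exceptional points are recovered by taking closures.
  · set Z : Set Y := ⋃ p ∈ s, F ∩ ⋂ i ∈ Finset.range n,
      F ∩ T^[i] ⁻¹' Metric.closedBall (T^[i] p) (1 / M)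
      with hZ
    have hTi : ∀ i, ContinuousOn T^[i] F := fun i => hT.iterate hTF i
    have hZc : IsClosed Z := isClosed_biUnion_finset fun p _ => hF.inter
      (isClosed_biInter fun i _ =>
        (hTi i).preimage_isClosed_of_isClosed hF Metric.isClosed_closedBall)
    have hsub : π '' (Ioo 0 1 \ {x ∈ X | ∃ i < n, f^[i] x ∉ ⋃₀ branches f}) ⊆ Z := by
      rintro _ ⟨x, ⟨hx, hx'⟩, rfl⟩
      have hxX := hf.Ioo_subset hx
      obtain ⟨C, hC, hxC⟩ := exists_cylinder (n := n) hx fun i hi => by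
        by_contra h
        exact hx' ⟨hxX, i, hi, h⟩
      obtain ⟨h1, h2⟩ := hrspec C x hxC
      have hmem : π (r (C, orbitCode f M n C x)) ∈ s := Finset.mem_image_of_mem _
        (Finset.mem_product.2 ⟨hfin.mem_toFinset.2 hC, Finset.mem_Icc.2 (orbitCode_mem hf hxX C)⟩)
      refine mem_biUnion hmem ⟨hπ hxX, mem_iInter₂.2 fun i hi => ⟨hπ hxX, ?_⟩⟩
      rw [mem_preimage, Metric.mem_closedBall, hiter i x hxX,
        hiter i _ (hf.Ioo_subset (cylinder_subset hC h1))]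
      exact (hdist _ _).trans
        (abs_sub_le_of_orbitCode_eq hM hC hxC h1 h2.symm (Finset.mem_range.1 hi))
    intro y hy
    have hyZ := closure_minimal hsub hZc (hdense _ (finite_exceptional_iterate hf n) hy)
    obtain ⟨p, hp, -, hyp⟩ := mem_iUnion₂.1 hyZ
    refine ⟨p, hp, Dynamics.mem_dynEntourage.2 fun i hi => hU _ _ ?_⟩
    exact (mem_iInter₂.1 hyp i (Finset.mem_range.2 hi)).2

/-- The map `π` treats the interval (identity) and the circle (projection) at once. Spanning sets
have as many points as there are cylinders, up to a factor linear in `n`. -/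
theorem coverEntropy_le {Y : Type*} [PseudoMetricSpace Y] {T : Y → Y} {F : Set Y} {π : ℝ → Y}
    (hf : IsPiecewiseMonotone f X) (hF : IsClosed F) (hT : ContinuousOn T F) (hTF : MapsTo T F F)
    (hπ : MapsTo π X F) (hsemi : ∀ x ∈ X, T (π x) = π (f x))
    (hdist : ∀ x y, dist (π x) (π y) ≤ |x - y|)
    (hdense : ∀ S : Set ℝ, S.Finite → F ⊆ closure (π '' (Ioo 0 1 \ S))) {c : ℝ}
    (hc : ∀ᶠ n : ℕ in atTop, ((cylinders f n).ncard : ENNReal) ≤ expE (n * c)) :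
    Dynamics.coverEntropy T F ≤ c := by
  refine iSup₂_le fun U hU => ?_
  obtain ⟨ε, hε, hεU⟩ := Metric.mem_uniformity_dist.1 hU
  obtain ⟨M, hM⟩ := exists_nat_gt (1 / ε)
  have hM0 : 0 < M := by
    rw [← Nat.cast_pos (α := ℝ)]
    exact (by positivity : 0 < 1 / ε).trans hM
  have hU' : ∀ x y : Y, dist x y ≤ 1 / M → (x, y) ∈ U := fun x y h => hεU (h.trans_lt (by
    rw [div_lt_comm₀ (by positivity) hε]
    exact hM))
  refine le_of_forall_gt fun c' hc' => ?_
  -- The gap `d - c` absorbs the linear factor.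
  obtain ⟨d, hcd, hdc⟩ := EReal.lt_iff_exists_real_btwn.1 hc'
  have hcd' : c < d := EReal.coe_lt_coe_iff.1 hcd
  refine lt_of_le_of_lt (limsup_le_of_le (by isBoundedDefault) ?_) hdc
  have hlin : ∀ᶠ n : ℕ in atTop, ((2 * n * M + 1 : ℕ) : ℝ) ≤ Real.exp (n * (d - c)) := by
    have hδ : 0 < d - c := by linarith
    have h1 : ∀ᶠ n : ℕ in atTop, (2 * (2 * M + 1)) / (d - c) ^ 2 ≤ (n : ℝ) :=
      tendsto_natCast_atTop_atTop.eventually_ge_atTop _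
    filter_upwards [h1, eventually_ge_atTop 1] with n hn hn1
    rw [div_le_iff₀ (by positivity)] at hn
    have hq := Real.quadratic_le_exp_of_nonneg (x := n * (d - c)) (by positivity)
    have hn1' : (1 : ℝ) ≤ n := by exact_mod_cast hn1
    have : 0 ≤ n * (d - c) := by positivity
    have h3 : (n : ℝ) * (2 * (2 * M + 1)) ≤ n * (n * (d - c) ^ 2) :=
      mul_le_mul_of_nonneg_left hn (by positivity)
    push_cast
    nlinarith
  filter_upwards [hc, hlin, eventually_ne_atTop 0] with n hn hlin h0
  refine log_div_le h0 ?_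
  obtain ⟨s, hs, hcard⟩ := exists_isDynCoverOf hf hF hT hTF hπ hsemi hdist hdense hM0 hU' n
  have h1 : (Dynamics.coverMincard T F U n : ENNReal) ≤ (s.card : ENNReal) := by
    exact_mod_cast ENat.toENNReal_mono hs.coverMincard_le_card
  have h2 : (s.card : ENNReal) ≤ (cylinders f n).ncard * ((2 * n * M + 1 : ℕ) : ENNReal) := by
    exact_mod_cast hcard
  refine h1.trans (h2.trans ?_)
  rw [show (n : ℝ) * d = n * c + n * (d - c) by ring, expE_add]
  refine mul_le_mul' hn ?_
  rw [expE, ← ENNReal.ofReal_natCast]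
  exact ENNReal.ofReal_le_ofReal hlin

end entropy

/-! ### Topological exactness -/

/-- A closed invariant set with interior contains the closure of every dense orbit. -/
theorem subset_of_dense_orbit {Y : Type*} [TopologicalSpace Y] [T1Space Y] {h : Y → Y}
    {F V O : Set Y} {x : Y} (hx : x ∈ F) (hF : MapsTo h F F)
    (hd : F ⊆ closure (range fun k : ℕ => h^[k] x))
    (hperf : ∀ O : Set Y, IsOpen O → (O ∩ F).Nonempty → (O ∩ F).Infinite)
    (hV : IsClosed V) (hinv : MapsTo h V V) (hO : IsOpen O) (hne : (O ∩ F).Nonempty)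
    (hOV : O ∩ F ⊆ V) : F ⊆ V := by
  obtain ⟨y, hyO, hyF⟩ := hne
  obtain ⟨_, hjO, j, rfl⟩ := mem_closure_iff.1 (hd hyF) O hO hyO
  have hjV : h^[j] x ∈ V := hOV ⟨hjO, hF.iterate j hx⟩
  -- The orbit visits only finitely many points before entering `V` for good, and finitely many
  -- points cannot fill a relatively open part of `F`.
  set S : Set Y := (fun i => h^[i] x) '' {i | i < j} with hS
  have hSfin : S.Finite := (finite_lt_nat j).image _
  have hsub : range (fun k : ℕ => h^[k] x) ⊆ S ∪ V := by
    rintro _ ⟨k, rfl⟩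
    rcases lt_or_ge k j with hk | hk
    · exact Or.inl ⟨k, hk, rfl⟩
    · right
      obtain ⟨i, rfl⟩ := Nat.exists_eq_add_of_le hk
      dsimp only
      rw [add_comm, Function.iterate_add_apply]
      exact hinv.iterate i hjV
  have hF' : F ⊆ S ∪ V := hd.trans (closure_minimal hsub (hSfin.isClosed.union hV))
  by_contra hcon
  obtain ⟨z, hzF, hzV⟩ := not_subset.1 hcon
  refine hperf Vᶜ hV.isOpen_compl ⟨z, hzV, hzF⟩ (hSfin.subset ?_)
  rintro w ⟨hwV, hwF⟩
  exact (hF' hwF).resolve_right hwV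

/-- Near a repelling fixed left endpoint without other preimages, right ends of the interval are
invariant. -/
theorem exists_trap_left {g : ℝ → ℝ} {p q d : ℝ} (hpq : p < q) (hc : ContinuousOn g (Icc p q))
    (hm : MapsTo g (Icc p q) (Icc p q)) (hp : g p = p)
    (hd : HasDerivWithinAt g d (Icc p q) p) (hd1 : 1 < |d|)
    (hpre : ∀ x ∈ Icc p q, g x = p → x = p) :
    ∃ r₀ > 0, ∀ r > 0, r ≤ r₀ → ∀ x ∈ Icc (p + r) q, p + r ≤ g x := by
  -- The tolerance `|d| - 1` leaves a slope of at least `1`. Since `g ≥ p`, points near `p` are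
  -- pushed away from `p`, whatever the sign of `d`.
  have hlit := (hasDerivWithinAt_iff_isLittleO.1 hd).bound (show 0 < |d| - 1 by linarith)
  have hmove : ∀ᶠ x in 𝓝[Icc p q] p, x ≤ g x := by
    filter_upwards [hlit, self_mem_nhdsWithin] with x hx hxI
    rw [hp, Real.norm_eq_abs, Real.norm_eq_abs, smul_eq_mul] at hx
    have h1 : |(x - p) * d| ≤ |g x - p| + |g x - p - (x - p) * d| := by
      have := abs_sub (g x - p) (g x - p - (x - p) * d)
      rwa [sub_sub_cancel] at this
    have h2 : 0 ≤ g x - p := by linarith [(hm hxI).1]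
    rw [abs_mul, abs_of_nonneg h2, abs_of_nonneg (sub_nonneg.2 hxI.1)] at h1
    rw [abs_of_nonneg (sub_nonneg.2 hxI.1)] at hx
    linarith
  obtain ⟨δ, hδ, hball⟩ := Metric.mem_nhdsWithin_iff.1 hmove
  set e := min (p + δ / 2) q with he
  have hpe : p < e := lt_min (by linarith) hpq
  have heq : e ≤ q := min_le_right _ _
  have hnear : ∀ x ∈ Icc p e, x ≤ g x := by
    intro x hx
    refine hball ⟨?_, hx.1, hx.2.trans heq⟩
    rw [Metric.mem_ball, Real.dist_eq, abs_of_nonneg (sub_nonneg.2 hx.1)]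
    linarith [hx.2.trans (min_le_left _ _)]
  have hsub : Icc e q ⊆ Icc p q := Icc_subset_Icc_left hpe.le
  -- Away from `p` the map has a minimum, which exceeds `p` because `p` has no other preimage.
  obtain ⟨y, hy, hmin⟩ := isCompact_Icc.exists_isMinOn (nonempty_Icc.2 heq) (hc.mono hsub)
  have hgy : p < g y := lt_of_le_of_ne (hm (hsub hy)).1 fun h =>
    (hpe.trans_le hy.1).ne' (hpre y (hsub hy) h.symm)
  refine ⟨g y - p, by linarith, fun r hr hr₀ x hx => ?_⟩
  rcases le_total x e with h | h
  · exact hx.1.trans (hnear x ⟨by linarith [hx.1], h⟩)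
  · have := hmin (show x ∈ Icc e q from ⟨h, hx.2⟩)
    simp only [mem_ofPred_eq] at this
    linarith

/-- The mirror image of `exists_trap_left` under `x ↦ -x`. -/
theorem exists_trap_right {g : ℝ → ℝ} {p q d : ℝ} (hpq : p < q) (hc : ContinuousOn g (Icc p q))
    (hm : MapsTo g (Icc p q) (Icc p q)) (hq : g q = q)
    (hd : HasDerivWithinAt g d (Icc p q) q) (hd1 : 1 < |d|)
    (hpre : ∀ x ∈ Icc p q, g x = q → x = q) :
    ∃ r₀ > 0, ∀ r > 0, r ≤ r₀ → ∀ x ∈ Icc p (q - r), g x ≤ q - r := by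
  have hneg : MapsTo Neg.neg (Icc (-q) (-p)) (Icc p q) := fun x hx =>
    ⟨by linarith [hx.2], by linarith [hx.1]⟩
  have hder : HasDerivWithinAt (fun x => -g (-x)) d (Icc (-q) (-p)) (-q) := by
    have h1 : HasDerivWithinAt g d (Icc p q) (- -q) := by rwa [neg_neg]
    have := (h1.comp (-q) (hasDerivAt_neg (-q)).hasDerivWithinAt hneg).neg
    rw [mul_neg_one, neg_neg] at this
    exact this
  obtain ⟨r₀, hr₀, h⟩ := exists_trap_left (g := fun x => -g (-x)) (neg_lt_neg hpq)
    ((hc.comp continuousOn_neg hneg).neg)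
    (fun x hx => ⟨neg_le_neg (hm (hneg hx)).2, neg_le_neg (hm (hneg hx)).1⟩) (by simp [hq])
    hder hd1 (fun x hx hxq => by
      have := hpre (-x) (hneg hx) (neg_injective hxq)
      linarith)
  refine ⟨r₀, hr₀, fun r hr hrr x hx => ?_⟩
  have := h r hr hrr (-x) ⟨by linarith [hx.2], by linarith [hx.1]⟩
  simp only [neg_neg] at this
  linarith

theorem closure_eq_Icc {K : Set ℝ} (hK : K.OrdConnected) (ha : BddAbove K) (hb : BddBelow K)
    {x y : ℝ} (hx : x ∈ K) (hy : y ∈ K) (hxy : x < y) : closure K = Icc (sInf K) (sSup K) := by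
  have hlt : sInf K < sSup K := (csInf_le hb hx).trans_lt (hxy.trans_le (le_csSup ha hy))
  have hconn : IsConnected K := ⟨⟨x, hx⟩, hK.isPreconnected⟩
  refine Subset.antisymm (closure_minimal (subset_Icc_csInf_csSup hb ha) isClosed_Icc) ?_
  rw [← closure_Ioo hlt.ne]
  exact closure_mono (hconn.Ioo_csInf_csSup_subset hb ha)

/-- A topologically exact behaviour: an interval that covers itself eventually covers everything,
provided that the square of the map has no proper invariant subinterval and repelling fixed
points. -/
theorem exists_iterate_cover {h : ℝ → ℝ} {p q : ℝ} (hpq : p < q) (hc : ContinuousOn h (Icc p q))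
    (hm : MapsTo h (Icc p q) (Icc p q))
    (hT : ∀ u v, p ≤ u → u < v → v ≤ q → MapsTo h^[2] (Icc u v) (Icc u v) → u = p ∧ v = q)
    (hR : ∀ e ∈ Icc p q, h^[2] e = e → ∃ d, 1 < |d| ∧ HasDerivWithinAt h^[2] d (Icc p q) e)
    {D : Set ℝ} (hD : D ⊆ Icc p q) (hDo : D.OrdConnected) {x₀ y₀ : ℝ} (hx₀ : x₀ ∈ D)
    (hy₀ : y₀ ∈ D) (hxy₀ : x₀ < y₀) (hDh : D ⊆ h '' D) : ∃ i, Icc p q ⊆ h^[i] '' D := by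
  have hci : ∀ i, ContinuousOn h^[i] (Icc p q) := fun i => hc.iterate hm i
  have hJoc : ∀ i, (h^[i] '' D).OrdConnected := fun i =>
    (hDo.isPreconnected.image _ ((hci i).mono hD)).ordConnected
  have hJsucc : ∀ i, h '' (h^[i] '' D) = h^[i + 1] '' D := fun i => by
    rw [Function.iterate_succ', image_comp]
  have hJmono : Monotone fun i => h^[i] '' D := monotone_nat_of_le_succ fun i => by
    rw [Function.iterate_succ, image_comp]
    exact image_mono hDh
  have hJsub : ∀ i, h^[i] '' D ⊆ Icc p q := by
    rintro i _ ⟨x, hx, rfl⟩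
    exact hm.iterate i (hD hx)
  set K : Set ℝ := ⋃ i, h^[i] '' D with hK
  have hKsub : K ⊆ Icc p q := iUnion_subset hJsub
  have hDK : D ⊆ K := fun x hx => mem_iUnion.2 ⟨0, x, hx, rfl⟩
  have hKoc : K.OrdConnected := by
    refine ⟨fun x hx y hy => ?_⟩
    obtain ⟨i, hi⟩ := mem_iUnion.1 hx
    obtain ⟨j, hj⟩ := mem_iUnion.1 hy
    exact ((hJoc (max i j)).out (hJmono (le_max_left i j) hi) (hJmono (le_max_right i j) hj)).trans
      (subset_iUnion (fun i => h^[i] '' D) _)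
  have hKm : MapsTo h K K := by
    intro x hx
    obtain ⟨i, hi⟩ := mem_iUnion.1 hx
    exact mem_iUnion.2 ⟨i + 1, hJsucc i ▸ mem_image_of_mem h hi⟩
  have hKimg : K ⊆ h '' K := by
    intro x hx
    obtain ⟨i, hi⟩ := mem_iUnion.1 hx
    have := hJmono (Nat.le_succ i) hi
    dsimp only at this
    rw [Nat.succ_eq_add_one, ← hJsucc] at this
    exact image_mono (subset_iUnion (fun i => h^[i] '' D) i) this
  have ha : BddAbove K := ⟨q, fun x hx => (hKsub hx).2⟩
  have hb : BddBelow K := ⟨p, fun x hx => (hKsub hx).1⟩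
  have hcl := closure_eq_Icc hKoc ha hb (hDK hx₀) (hDK hy₀) hxy₀
  have hclsub : closure K ⊆ Icc p q := closure_minimal hKsub isClosed_Icc
  have hclm : MapsTo h (closure K) (closure K) := hKm.closure_of_continuousOn (hc.mono hclsub)
  have hlt : sInf K < sSup K :=
    (csInf_le hb (hDK hx₀)).trans_lt (hxy₀.trans_le (le_csSup ha (hDK hy₀)))
  -- The closure of the increasing union `K` is an invariant interval, hence all of `[p, q]`. Only
  -- the endpoints can be missing from `K`.
  obtain ⟨hu, hv⟩ := hT (sInf K) (sSup K) (le_csInf ⟨x₀, hDK hx₀⟩ fun x hx => (hKsub hx).1) hlt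
    (csSup_le ⟨x₀, hDK hx₀⟩ fun x hx => (hKsub hx).2) (by rw [← hcl]; exact hclm.iterate 2)
  have hIoo : Ioo p q ⊆ K := by
    have := IsConnected.Ioo_csInf_csSup_subset ⟨⟨x₀, hDK hx₀⟩, hKoc.isPreconnected⟩ hb ha
    rwa [hu, hv] at this
  have hsurj : Icc p q ⊆ h '' Icc p q := by
    rw [← closure_Ioo hpq.ne]
    refine closure_minimal (hIoo.trans (hKimg.trans ?_)) ?_
    · rw [closure_Ioo hpq.ne]
      exact image_mono hKsub
    · rw [closure_Ioo hpq.ne]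
      exact (isCompact_Icc.image_of_continuousOn hc).isClosed
  have hout : ∀ x ∈ Icc p q, x ∉ K → x = p ∨ x = q := by
    intro x hx hxK
    by_contra! hne
    exact hxK (hIoo ⟨lt_of_le_of_ne hx.1 hne.1.symm, lt_of_le_of_ne hx.2 hne.2⟩)
  have hpI : p ∈ Icc p q := left_mem_Icc.2 hpq.le
  have hqI : q ∈ Icc p q := right_mem_Icc.2 hpq.le
  have hm2 : MapsTo h^[2] (Icc p q) (Icc p q) := hm.iterate 2
  have htwo : ∀ x, h^[2] x = h (h x) := fun x => rfl
  have hnot : ∀ x, h x ∉ K → x ∉ K := fun x hx hxK => hx (hKm hxK)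
  -- Preimages of a missing endpoint are missing too, while `h` is onto. So missing endpoints are
  -- fixed or exchanged by `h`, fixed by the square, and repelling without preimages from `K`.
  -- Cutting off a small piece at each of them leaves a proper invariant interval of the square,
  -- against `hT`.
  by_cases hpK : p ∈ K <;> by_cases hqK : q ∈ K
  · obtain ⟨i, hi⟩ := mem_iUnion.1 hpK
    obtain ⟨j, hj⟩ := mem_iUnion.1 hqK
    exact ⟨max i j, (hJoc _).out (hJmono (le_max_left i j) hi) (hJmono (le_max_right i j) hj)⟩
  · exfalso
    have hpre : ∀ x ∈ Icc p q, h x = q → x = q := fun x hx hxq =>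
      (hout x hx (hnot x (hxq ▸ hqK))).resolve_left fun hxp =>
        hnot x (hxq ▸ hqK) (hxp ▸ hpK)
    obtain ⟨y, hy, hyq⟩ := hsurj hqI
    have hq : h q = q := by
      have := hpre y hy hyq
      rwa [this] at hyq
    have hq2 : h^[2] q = q := by rw [htwo, hq, hq]
    obtain ⟨d, hd1, hd⟩ := hR q hqI hq2
    obtain ⟨r₀, hr₀, htrap⟩ := exists_trap_right hpq (hci 2) hm2 hq2 hd hd1
      fun x hx hxq => hpre x hx (hpre (h x) (hm hx) hxq)
    set r := min r₀ ((q - p) / 2) with hr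
    have hrpos : 0 < r := lt_min hr₀ (by linarith)
    have hrle : r ≤ (q - p) / 2 := min_le_right _ _
    have := (hT p (q - r) le_rfl (by linarith) (by linarith) fun x hx =>
      ⟨(hm2 ⟨hx.1, by linarith [hx.2]⟩).1, htrap r hrpos (min_le_left _ _) x hx⟩).2
    linarith
  · exfalso
    have hpre : ∀ x ∈ Icc p q, h x = p → x = p := fun x hx hxp =>
      (hout x hx (hnot x (hxp ▸ hpK))).resolve_right fun hxq =>
        hnot x (hxp ▸ hpK) (hxq ▸ hqK)
    obtain ⟨y, hy, hyp⟩ := hsurj hpI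
    have hp : h p = p := by
      have := hpre y hy hyp
      rwa [this] at hyp
    have hp2 : h^[2] p = p := by rw [htwo, hp, hp]
    obtain ⟨d, hd1, hd⟩ := hR p hpI hp2
    obtain ⟨r₀, hr₀, htrap⟩ := exists_trap_left hpq (hci 2) hm2 hp2 hd hd1
      fun x hx hxp => hpre x hx (hpre (h x) (hm hx) hxp)
    set r := min r₀ ((q - p) / 2) with hr
    have hrpos : 0 < r := lt_min hr₀ (by linarith)
    have hrle : r ≤ (q - p) / 2 := min_le_right _ _
    have := (hT (p + r) q (by linarith) (by linarith) le_rfl fun x hx =>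
      ⟨htrap r hrpos (min_le_left _ _) x hx, (hm2 ⟨by linarith [hx.1], hx.2⟩).2⟩).1
    linarith
  · exfalso
    have hpre : ∀ x ∈ Icc p q, h x = p ∨ h x = q → x = p ∨ x = q := by
      rintro x hx (h' | h')
      · exact hout x hx (hnot x (h' ▸ hpK))
      · exact hout x hx (hnot x (h' ▸ hqK))
    have hfix : h^[2] p = p ∧ h^[2] q = q := by
      obtain ⟨y, hy, hyp⟩ := hsurj hpI
      obtain ⟨z, hz, hzq⟩ := hsurj hqI
      rw [htwo, htwo]
      rcases hpre y hy (Or.inl hyp) with rfl | rfl <;> rcases hpre z hz (Or.inr hzq) with rfl | rfl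
      · exact absurd (hyp.symm.trans hzq) hpq.ne
      · exact ⟨by rw [hyp, hyp], by rw [hzq, hzq]⟩
      · exact ⟨by rw [hzq, hyp], by rw [hyp, hzq]⟩
      · exact absurd (hyp.symm.trans hzq) hpq.ne
    have hpre2 : ∀ x ∈ Icc p q, h^[2] x = p ∨ h^[2] x = q → x = p ∨ x = q :=
      fun x hx h' => hpre x hx (hpre (h x) (hm hx) h')
    obtain ⟨d, hd1, hd⟩ := hR p hpI hfix.1
    obtain ⟨d', hd1', hd'⟩ := hR q hqI hfix.2
    obtain ⟨r₁, hr₁, htrap₁⟩ := exists_trap_left hpq (hci 2) hm2 hfix.1 hd hd1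
      fun x hx hxp => (hpre2 x hx (Or.inl hxp)).resolve_right fun hxq => by
        rw [hxq, hfix.2] at hxp
        exact hpq.ne' hxp
    obtain ⟨r₂, hr₂, htrap₂⟩ := exists_trap_right hpq (hci 2) hm2 hfix.2 hd' hd1'
      fun x hx hxq => (hpre2 x hx (Or.inr hxq)).resolve_left fun hxp => by
        rw [hxp, hfix.1] at hxq
        exact hpq.ne hxq
    set r := min (min r₁ r₂) ((q - p) / 3) with hr
    have hrpos : 0 < r := lt_min (lt_min hr₁ hr₂) (by linarith)
    have hrle : r ≤ (q - p) / 3 := min_le_right _ _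
    have hle₁ : r ≤ r₁ := (min_le_left _ _).trans (min_le_left _ _)
    have hle₂ : r ≤ r₂ := (min_le_left _ _).trans (min_le_right _ _)
    have := (hT (p + r) (q - r) (by linarith) (by linarith) (by linarith) fun x hx =>
      ⟨htrap₁ r hrpos hle₁ x ⟨hx.1, by linarith [hx.2]⟩,
        htrap₂ r hrpos hle₂ x ⟨by linarith [hx.1], hx.2⟩⟩).1
    linarith

/-- A map that is, up to a constant, a `C²` function with non-zero derivative near `x` has an
interval of monotonicity around `x`. -/
theorem exists_isMonotoneInterval {f F : ℝ → ℝ} {x c : ℝ} (hx : x ∈ Ioo (0 : ℝ) 1)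
    (hF : ContDiffAt ℝ 2 F x) (hd : deriv F x ≠ 0) (heq : ∀ᶠ y in 𝓝 x, f y = F y + c) :
    ∃ J, IsMonotoneInterval f J ∧ x ∈ J := by
  have hcont : ContinuousAt (deriv F) x := by
    have h1 := hF.continuousAt_fderiv two_ne_zero
    have : deriv F = fun y => fderiv ℝ F y 1 := by ext; simp
    rw [this]
    exact h1.clm_apply continuousAt_const
  have hdiff : ∀ᶠ y in 𝓝 x, DifferentiableAt ℝ F y :=
    ((hF.eventually (by simp)).mono fun y hy => hy.differentiableAt two_ne_zero)
  have hIoo : ∀ᶠ y in 𝓝 x, y ∈ Ioo (0 : ℝ) 1 := isOpen_Ioo.mem_nhds hx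
  rcases hd.lt_or_gt with hneg | hpos
  · obtain ⟨ε, hε, hball⟩ := Metric.mem_nhds_iff.1
      (((hcont.eventually_lt_const hneg).and hdiff).and (hIoo.and heq))
    have hcon : ContinuousOn F (Metric.ball x ε) := fun y hy =>
      (hball hy).1.2.continuousAt.continuousWithinAt
    have hs : StrictAntiOn F (Metric.ball x ε) := strictAntiOn_of_deriv_neg (convex_ball x ε) hcon
      (by rw [Metric.isOpen_ball.interior_eq]; exact fun y hy => (hball hy).1.1)
    refine ⟨Metric.ball x ε, ⟨Metric.isOpen_ball, ⟨x, Metric.mem_ball_self hε⟩,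
      (convex_ball x ε).ordConnected, fun y hy => (hball hy).2.1, ?_, Or.inr ?_⟩,
      Metric.mem_ball_self hε⟩
    · exact (hcon.add continuousOn_const).congr fun y hy => (hball hy).2.2
    · intro y hy z hz hyz
      rw [(hball hy).2.2, (hball hz).2.2]
      linarith [hs hy hz hyz]
  · obtain ⟨ε, hε, hball⟩ := Metric.mem_nhds_iff.1
      (((hcont.eventually_const_lt hpos).and hdiff).and (hIoo.and heq))
    have hcon : ContinuousOn F (Metric.ball x ε) := fun y hy =>
      (hball hy).1.2.continuousAt.continuousWithinAt
    have hs : StrictMonoOn F (Metric.ball x ε) := strictMonoOn_of_deriv_pos (convex_ball x ε) hcon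
      (by rw [Metric.isOpen_ball.interior_eq]; exact fun y hy => (hball hy).1.1)
    refine ⟨Metric.ball x ε, ⟨Metric.isOpen_ball, ⟨x, Metric.mem_ball_self hε⟩,
      (convex_ball x ε).ordConnected, fun y hy => (hball hy).2.1, ?_, Or.inl ?_⟩,
      Metric.mem_ball_self hε⟩
    · exact (hcon.add continuousOn_const).congr fun y hy => (hball hy).2.2
    · intro y hy z hz hyz
      rw [(hball hy).2.2, (hball hz).2.2]
      linarith [hs hy hz hyz]

theorem finite_exceptional_of_exists {f : ℝ → ℝ} {Z : Set ℝ} (hZ : Z.Finite)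
    (h : ∀ x ∈ Ioo (0 : ℝ) 1, x ∉ Z → ∃ J, IsMonotoneInterval f J ∧ x ∈ J) :
    (Icc (0 : ℝ) 1 \ ⋃₀ branches f).Finite := by
  refine (hZ.union (toFinite {0, 1})).subset ?_
  rintro x ⟨hx, hx'⟩
  by_contra hcon
  simp only [mem_union, mem_insert_iff, mem_singleton_iff, not_or] at hcon
  obtain ⟨J, hJ, hxJ⟩ := h x ⟨lt_of_le_of_ne hx.1 (Ne.symm hcon.2.1),
    lt_of_le_of_ne hx.2 hcon.2.2⟩ hcon.1
  obtain ⟨A, hA, hJA⟩ := hJ.exists_branch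
  exact hx' ⟨A, hA, hJA hxJ⟩

theorem Icc_subset_closure_diff {S : Set ℝ} (hS : S.Finite) :
    Icc (0 : ℝ) 1 ⊆ closure (Ioo 0 1 \ S) := by
  rw [← closure_Ioo zero_ne_one]
  refine closure_minimal ?_ isClosed_closure
  have := (hS.countable.dense_compl ℝ).open_subset_closure_inter
    (isOpen_Ioo (a := (0 : ℝ)) (b := 1))
  rwa [← sdiff_eq] at this

/-! ### Interval maps -/

theorem Icc_inter_infinite {O : Set ℝ} (hO : IsOpen O) (h : (O ∩ Icc (0 : ℝ) 1).Nonempty) :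
    (O ∩ Icc (0 : ℝ) 1).Infinite := by
  obtain ⟨x, hxO, hx⟩ := h
  rw [← closure_Ioo zero_ne_one] at hx
  obtain ⟨y, hyO, hy⟩ := mem_closure_iff.1 hx O hO hxO
  exact infinite_of_mem_nhds y (mem_of_superset ((hO.inter isOpen_Ioo).mem_nhds ⟨hyO, hy⟩)
    (inter_subset_inter_right _ Ioo_subset_Icc_self))

/-- A dense orbit of `fⁿ` enters the interior of `[u, v]` and stays in `[u, v]` from then on. -/
theorem IsIntervalMapH.invariant_eq {f : ℝ → ℝ} (hf : IsIntervalMapH f) {n : ℕ} (hn : 1 ≤ n)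
    {u v : ℝ} (hu : 0 ≤ u) (huv : u < v) (hv : v ≤ 1)
    (h : MapsTo f^[n] (Icc u v) (Icc u v)) : u = 0 ∧ v = 1 := by
  obtain ⟨x, hx, hd⟩ := hf.mixing n hn
  have hm : (u + v) / 2 ∈ Ioo u v := ⟨by linarith, by linarith⟩
  have hsub : Icc (0 : ℝ) 1 ⊆ Icc u v := subset_of_dense_orbit hx (hf.mapsTo.iterate n) hd
    (fun O => Icc_inter_infinite) isClosed_Icc h isOpen_Ioo
    ⟨_, hm, by linarith [hm.1], by linarith [hm.2]⟩
    (inter_subset_left.trans Ioo_subset_Icc_self)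
  have h0 := hsub (left_mem_Icc.2 zero_le_one)
  have h1 := hsub (right_mem_Icc.2 zero_le_one)
  exact ⟨le_antisymm h0.1 hu, le_antisymm hv h1.2⟩

theorem IsIntervalMapH.isPiecewiseMonotone {f : ℝ → ℝ} (hf : IsIntervalMapH f) :
    IsPiecewiseMonotone f (Icc 0 1) where
  Ioo_subset := Ioo_subset_Icc_self
  subset_Icc := Subset.rfl
  mapsTo := hf.mapsTo
  finite_exceptional := by
    refine finite_exceptional_of_exists hf.finite_crit fun x hx hxZ => ?_
    have hnhds : Icc (0 : ℝ) 1 ∈ 𝓝 x := Icc_mem_nhds hx.1 hx.2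
    refine exists_isMonotoneInterval (F := f) (c := 0) hx (hf.contDiffOn.contDiffAt hnhds) ?_
      (by simp)
    rw [← derivWithin_of_mem_nhds hnhds]
    exact fun h => hxZ ⟨Ioo_subset_Icc_self hx, h⟩
  not_invariant := by
    intro n hn p q hp hpq hq h
    exact hp.ne' (hf.invariant_eq hn hp.le hpq hq.le h).1
  covers := by
    rintro D hD hDo ⟨x, hx⟩ hDsub k hk hDk
    obtain ⟨y, hy, hxy⟩ := exists_gt_mem_of_isOpen hD hx
    have hk2 : 1 ≤ k * 2 := by omega
    have htwo : (f^[k])^[2] = f^[k * 2] := (Function.iterate_mul f k 2).symm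
    obtain ⟨i, hi⟩ := exists_iterate_cover (h := f^[k]) (D := D) zero_lt_one
      (hf.contDiffOn.continuousOn.iterate hf.mapsTo k) (hf.mapsTo.iterate k)
      (fun u v hu huv hv h => hf.invariant_eq hk2 hu huv hv (htwo ▸ h))
      (fun e he hfix => by
        rw [htwo] at hfix ⊢
        have hd := hf.repelling e he _ hk2 hfix
        refine ⟨_, hd, (differentiableWithinAt_of_derivWithin_ne_zero ?_).hasDerivWithinAt⟩
        intro h0
        rw [h0, abs_zero] at hd
        linarith)
      (hDsub.trans Ioo_subset_Icc_self) hDo hx hy hxy hDk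
    refine ⟨k * i, ?_⟩
    rw [Function.iterate_mul]
    exact Ioo_subset_Icc_self.trans hi

theorem IsIntervalMapH.coverEntropy_le {f : ℝ → ℝ} (hf : IsIntervalMapH f) {c : ℝ}
    (hc : ∀ᶠ n : ℕ in atTop, ((cylinders f n).ncard : ENNReal) ≤ expE (n * c)) :
    Dynamics.coverEntropy f (Icc 0 1) ≤ c := by
  refine HofbauerTower.coverEntropy_le (π := id) hf.isPiecewiseMonotone isClosed_Icc
    hf.contDiffOn.continuousOn hf.mapsTo (mapsTo_id _) (fun _ _ => rfl)
    (fun x y => (Real.dist_eq x y).le) (fun S hS => ?_) hc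
  rw [image_id]
  exact Icc_subset_closure_diff hS

/-! ### Circle maps -/

section circle

variable {g : UnitAddCircle → UnitAddCircle} {F : ℝ → ℝ}

theorem coe_eq_coe_iff_exists_int {x y : ℝ} :
    (x : UnitAddCircle) = (y : UnitAddCircle) ↔ ∃ j : ℤ, x = y + j := by
  rw [← sub_eq_zero, ← AddCircle.coe_sub, AddCircle.coe_eq_zero_iff]
  simp only [zsmul_eq_mul, mul_one]
  exact ⟨fun ⟨j, hj⟩ => ⟨j, by linarith⟩, fun ⟨j, hj⟩ => ⟨j, by linarith⟩⟩

theorem coe_injOn_Ico {x y : ℝ} (hx : x ∈ Ico (0 : ℝ) 1) (hy : y ∈ Ico (0 : ℝ) 1)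
    (h : (x : UnitAddCircle) = (y : UnitAddCircle)) : x = y :=
  (AddCircle.coe_eq_coe_iff_of_mem_Ico (a := 0) (p := 1) (by simpa using hx) (by simpa using hy)).1 h

theorem circleRep_mem (g : UnitAddCircle → UnitAddCircle) (x : ℝ) :
    circleRep g x ∈ Ico (0 : ℝ) 1 := by
  have := (AddCircle.equivIco (1 : ℝ) 0 (g (x : UnitAddCircle))).2
  exact ⟨this.1, this.2.trans_eq (zero_add 1)⟩

theorem coe_circleRep (g : UnitAddCircle → UnitAddCircle) (x : ℝ) :
    (circleRep g x : UnitAddCircle) = g x :=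
  AddCircle.coe_equivIco (p := 1) (a := 0)

theorem coe_circleRep_iterate (g : UnitAddCircle → UnitAddCircle) (n : ℕ) (x : ℝ) :
    ((circleRep g)^[n] x : UnitAddCircle) = g^[n] x := by
  induction n with
  | zero => rfl
  | succ n ih => rw [Function.iterate_succ_apply', coe_circleRep, ih, Function.iterate_succ_apply']

theorem coe_lift_iterate (hF : ∀ x : ℝ, g (x : UnitAddCircle) = (F x : UnitAddCircle)) (n : ℕ)
    (x : ℝ) : (F^[n] x : UnitAddCircle) = g^[n] x := by
  induction n with
  | zero => rfl
  | succ n ih => rw [Function.iterate_succ_apply', ← hF, ih, Function.iterate_succ_apply']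

theorem circle_infinite {O : Set UnitAddCircle} (hO : IsOpen O) (h : O.Nonempty) : O.Infinite := by
  obtain ⟨y, hy⟩ := h
  obtain ⟨x, rfl⟩ := QuotientAddGroup.mk_surjective y
  have hpre : IsOpen ((fun x : ℝ => (x : UnitAddCircle)) ⁻¹' O) :=
    hO.preimage (AddCircle.continuous_mk' 1)
  have hcount : (Ioo x (x + 1) ∩ (fun x : ℝ => (x : UnitAddCircle)) ⁻¹' O).Infinite := by
    have h1 : ∀ᶠ z in 𝓝[>] x, z ∈ (fun x : ℝ => (x : UnitAddCircle)) ⁻¹' O :=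
      mem_nhdsWithin_of_mem_nhds (hpre.mem_nhds hy)
    obtain ⟨z, hz, hxz⟩ := (h1.and (Ioo_mem_nhdsGT (show x < x + 1 by linarith))).exists
    exact infinite_of_mem_nhds z ((isOpen_Ioo.inter hpre).mem_nhds ⟨hxz, hz⟩)
  refine (Set.Infinite.image (f := fun x : ℝ => (x : UnitAddCircle)) ?_ hcount).mono ?_
  · exact fun z hz w hw h => (AddCircle.coe_eq_coe_iff_of_mem_Ico (a := x) (p := 1)
      (Ioo_subset_Ico_self hz.1) (Ioo_subset_Ico_self hw.1)).1 h
  · rintro _ ⟨z, hz, rfl⟩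
    exact hz.2

theorem IsCircleMapH.one_le_of_invariant (hg : IsCircleMapH g) {n : ℕ} (hn : 1 ≤ n) {u v : ℝ}
    (huv : u < v) (h : ∀ x ∈ Icc u v, ∃ y ∈ Icc u v, g^[n] (x : UnitAddCircle) = y) :
    1 ≤ v - u := by
  by_contra! hlt
  obtain ⟨x, hd⟩ := hg.mixing n hn
  set V : Set UnitAddCircle := (fun x : ℝ => (x : UnitAddCircle)) '' Icc u v with hV
  have hcont : Continuous fun x : ℝ => (x : UnitAddCircle) := AddCircle.continuous_mk' 1
  have hVc : IsClosed V := (isCompact_Icc.image hcont).isClosed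
  have hO : IsOpen ((fun x : ℝ => (x : UnitAddCircle)) '' Ioo u v) :=
    QuotientAddGroup.isOpenMap_coe _ isOpen_Ioo
  have hsub : (univ : Set UnitAddCircle) ⊆ V := by
    refine subset_of_dense_orbit (mem_univ x) (mapsTo_univ _ _) hd.closure_eq.ge
      (fun O hO hne => ?_) hVc ?_ hO ?_ ?_
    · rw [inter_univ] at hne ⊢
      exact circle_infinite hO hne
    · rintro _ ⟨x, hx, rfl⟩
      obtain ⟨y, hy, hxy⟩ := h x hx
      exact ⟨y, hy, hxy.symm⟩
    · rw [inter_univ]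
      exact (nonempty_Ioo.2 huv).image _
    · rw [inter_univ]
      exact image_mono Ioo_subset_Icc_self
  -- The midpoint of the gap between `v` and `u + 1` has no translate in `[u, v]`.
  obtain ⟨y, hy, hyw⟩ := hsub (mem_univ (((u + v + 1) / 2 : ℝ) : UnitAddCircle))
  obtain ⟨j, hj⟩ := coe_eq_coe_iff_exists_int.1 hyw
  have h1 : (-1 : ℝ) < j := by linarith [hy.1]
  have h2 : (j : ℝ) < 0 := by linarith [hy.2]
  have h1' : (-1 : ℤ) < j := by exact_mod_cast h1
  have h2' : j < (0 : ℤ) := by exact_mod_cast h2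
  omega

theorem eq_of_continuous_of_int {u : ℝ → ℝ} (hu : Continuous u) (h : ∀ x, ∃ j : ℤ, u x = j)
    (x y : ℝ) : u x = u y := by
  have key : ∀ x y, ¬ u x < u y := by
    intro x y hxy
    have hoc : (range u).OrdConnected := (isPreconnected_range hu).ordConnected
    obtain ⟨i, hi⟩ := h x
    obtain ⟨j, hj⟩ := h y
    have hij : i + 1 ≤ j := by
      rw [hi, hj] at hxy
      exact_mod_cast hxy
    have hij' : (i : ℝ) + 1 ≤ j := by exact_mod_cast hij
    obtain ⟨z, hz⟩ := hoc.out ⟨x, rfl⟩ ⟨y, rfl⟩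
      (show (i : ℝ) + 1 / 2 ∈ Icc (u x) (u y) from ⟨by rw [hi]; linarith, by rw [hj]; linarith⟩)
    obtain ⟨k, hk⟩ := h z
    rw [hz] at hk
    have h1 : (i : ℝ) < k := by linarith
    have h2 : (k : ℝ) < i + 1 := by linarith
    have h1' : i < k := by exact_mod_cast h1
    have h2' : k < i + 1 := by exact_mod_cast h2
    omega
  exact le_antisymm (not_lt.1 (key y x)) (not_lt.1 (key x y))

/-- The integer part is constant on an interval that avoids the integers. -/
theorem floor_sub_eq_of_avoid {S : Set ℝ} (hS : S.OrdConnected) {w : ℝ}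
    (hw : ∀ j : ℤ, w + j ∉ S) {x y : ℝ} (hx : x ∈ S) (hy : y ∈ S) : ⌊x - w⌋ = ⌊y - w⌋ := by
  have key : ∀ {x y : ℝ}, x ∈ S → y ∈ S → ¬ ⌊x - w⌋ < ⌊y - w⌋ := by
    intro x y hx hy hlt
    have h1 := Int.floor_lt.1 hlt
    have h2 := Int.floor_le (y - w)
    exact hw ⌊y - w⌋ (hS.out hx hy ⟨by linarith, by linarith⟩)
  exact le_antisymm (not_lt.1 (key hy hx)) (not_lt.1 (key hx hy))

/-- If `gᵏ(D)` misses a point `w`, the real line can be cut at the translates of `w`. Then `D ⊆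
gᵏ(D)` lifts to `D ⊆ H(D)` for one lift `H` of `gᵏ`, and either the images of `D` under `H` reach
length `1` or `exists_iterate_cover` applies to the closure of their union. -/
theorem IsCircleMapH.exists_covers (hg : IsCircleMapH g) {D : Set ℝ} (hD : IsOpen D)
    (hDo : D.OrdConnected) (hne : D.Nonempty) {k : ℕ} (hk : 1 ≤ k)
    (hDk : D ⊆ (circleRep g)^[k] '' D) : ∃ N, Ioo 0 1 ⊆ (circleRep g)^[N] '' D := by
  obtain ⟨F, hFc, hF, -, -, hrep⟩ := hg.smooth
  obtain ⟨x₀, hx₀⟩ := hne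
  obtain ⟨y₀, hy₀, hxy₀⟩ := exists_gt_mem_of_isOpen hD hx₀
  have hcover : ∀ N ≥ 1, (∀ z : ℝ, ∃ x ∈ D, g^[N] (x : UnitAddCircle) = z) →
      Ioo 0 1 ⊆ (circleRep g)^[N] '' D := by
    intro N hN h z hz
    obtain ⟨x, hx, hxz⟩ := h z
    refine ⟨x, hx, coe_injOn_Ico ?_ (Ioo_subset_Ico_self hz) ?_⟩
    · obtain ⟨N, rfl⟩ := Nat.exists_eq_add_of_le' hN
      rw [Function.iterate_succ_apply']
      exact circleRep_mem g _
    · rw [coe_circleRep_iterate, hxz]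
  by_cases hsurj : ∀ z : ℝ, ∃ x ∈ D, g^[k] (x : UnitAddCircle) = z
  · exact ⟨k, hcover k hk hsurj⟩
  push Not at hsurj
  obtain ⟨w, hw⟩ := hsurj
  have hFk : Continuous F^[k] := hFc.continuous.iterate k
  have hDk' : ∀ y ∈ D, ∃ x ∈ D, ∃ j : ℤ, y = F^[k] x + j := by
    intro y hy
    obtain ⟨x, hx, rfl⟩ := hDk hy
    refine ⟨x, hx, coe_eq_coe_iff_exists_int.1 ?_⟩
    rw [coe_circleRep_iterate, coe_lift_iterate hF]
  have hIoc : (F^[k] '' D).OrdConnected :=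
    (hDo.isPreconnected.image _ hFk.continuousOn).ordConnected
  have hIavoid : ∀ j : ℤ, w + j ∉ F^[k] '' D := by
    rintro j ⟨x, hx, hxj⟩
    refine hw x hx ?_
    rw [← coe_lift_iterate hF]
    exact coe_eq_coe_iff_exists_int.2 ⟨j, hxj⟩
  have hDavoid : ∀ j : ℤ, w + j ∉ D := by
    intro j hj
    obtain ⟨x, hx, i, hi⟩ := hDk' _ hj
    exact hIavoid (j - i) ⟨x, hx, by push_cast; linarith⟩
  -- Both `D` and `F^[k] '' D` avoid the translates of `w`, so a single integer shift matches them.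
  set c : ℤ := ⌊x₀ - w⌋ - ⌊F^[k] x₀ - w⌋ with hc
  set H : ℝ → ℝ := fun x => F^[k] x + c with hH
  have hDH : D ⊆ H '' D := by
    intro y hy
    obtain ⟨x, hx, j, hj⟩ := hDk' y hy
    have h1 := floor_sub_eq_of_avoid hDo hDavoid hy hx₀
    have h2 := floor_sub_eq_of_avoid hIoc hIavoid ⟨x, hx, rfl⟩ ⟨x₀, hx₀, rfl⟩
    have h3 : ⌊y - w⌋ = ⌊F^[k] x - w⌋ + j := by
      rw [hj, ← Int.floor_add_intCast]
      congr 1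
      ring
    have h4 : j = c := by omega
    exact ⟨x, hx, by rw [hj, h4]⟩
  have hHc : Continuous H := hFk.add continuous_const
  have hHlift : ∀ x : ℝ, g^[k] (x : UnitAddCircle) = (H x : UnitAddCircle) := fun x => by
    rw [← coe_lift_iterate hF]
    exact (coe_eq_coe_iff_exists_int.2 ⟨c, rfl⟩).symm
  have hHi : ∀ i (x : ℝ), (H^[i] x : UnitAddCircle) = g^[k * i] x := fun i x => by
    rw [coe_lift_iterate hHlift, ← Function.iterate_mul]
  have hJoc : ∀ i, (H^[i] '' D).OrdConnected := fun i =>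
    (hDo.isPreconnected.image _ (hHc.iterate i).continuousOn).ordConnected
  have hJmono : Monotone fun i => H^[i] '' D := monotone_nat_of_le_succ fun i => by
    rw [Function.iterate_succ, image_comp]
    exact image_mono hDH
  by_cases hlong : ∃ i, ∃ x ∈ H^[i] '' D, x + 1 ∈ H^[i] '' D
  · obtain ⟨i, x, hx, hx1⟩ := hlong
    have hx' := hJmono (Nat.le_succ i) hx
    have hx1' := hJmono (Nat.le_succ i) hx1
    -- Passing from `i` to `i + 1` makes the exponent positive, as `hcover` requires.
    refine ⟨k * (i + 1), hcover _ (Nat.mul_pos hk (Nat.succ_pos i)) fun z => ?_⟩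
    have hz : x + Int.fract (z - x) ∈ H^[i + 1] '' D := (hJoc (i + 1)).out hx' hx1'
      ⟨by linarith [Int.fract_nonneg (z - x)], by linarith [Int.fract_lt_one (z - x)]⟩
    obtain ⟨y, hy, hyz⟩ := hz
    refine ⟨y, hy, ?_⟩
    rw [← hHi, hyz]
    refine coe_eq_coe_iff_exists_int.2 ⟨-⌊z - x⌋, ?_⟩
    rw [Int.fract]
    push_cast
    ring
  push Not at hlong
  exfalso
  set K : Set ℝ := ⋃ i, H^[i] '' D with hK
  have hDK : D ⊆ K := fun x hx => mem_iUnion.2 ⟨0, x, hx, rfl⟩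
  have hKoc : K.OrdConnected := by
    refine ⟨fun x hx y hy => ?_⟩
    obtain ⟨i, hi⟩ := mem_iUnion.1 hx
    obtain ⟨j, hj⟩ := mem_iUnion.1 hy
    exact ((hJoc (max i j)).out (hJmono (le_max_left i j) hi) (hJmono (le_max_right i j) hj)).trans
      (subset_iUnion (fun i => H^[i] '' D) _)
  have hKm : MapsTo H K K := by
    intro x hx
    obtain ⟨i, z, hz, rfl⟩ := mem_iUnion.1 hx
    exact mem_iUnion.2 ⟨i + 1, z, hz, Function.iterate_succ_apply' H i z⟩
  have hKlen : ∀ x ∈ K, ∀ y ∈ K, y < x + 1 := by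
    intro x hx y hy
    by_contra! h
    obtain ⟨i, hi⟩ := mem_iUnion.1 hx
    obtain ⟨j, hj⟩ := mem_iUnion.1 hy
    have hi' := hJmono (le_max_left i j) hi
    have hj' := hJmono (le_max_right i j) hj
    exact hlong (max i j) x hi' ((hJoc _).out hi' hj' ⟨by linarith, h⟩)
  have ha : BddAbove K := ⟨x₀ + 1, fun y hy => (hKlen x₀ (hDK hx₀) y hy).le⟩
  have hb : BddBelow K := ⟨x₀ - 1, fun y hy => by linarith [hKlen y hy x₀ (hDK hx₀)]⟩
  have hcl := closure_eq_Icc hKoc ha hb (hDK hx₀) (hDK hy₀) hxy₀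
  set p := sInf K with hp
  set q := sSup K with hq
  have hpq : p < q := (csInf_le hb (hDK hx₀)).trans_lt (hxy₀.trans_le (le_csSup ha (hDK hy₀)))
  have hlen : q ≤ p + 1 := by
    refine csSup_le ⟨x₀, hDK hx₀⟩ fun y hy => ?_
    have : y - 1 ≤ p := le_csInf ⟨x₀, hDK hx₀⟩ fun x hx => by linarith [hKlen x hx y hy]
    linarith
  have hHm : MapsTo H (Icc p q) (Icc p q) := by
    rw [← hcl]
    exact hKm.closure hHc
  have hinv : ∀ i ≥ 1, ∀ u v : ℝ, u < v → MapsTo H^[i] (Icc u v) (Icc u v) → 1 ≤ v - u :=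
    fun i hi u v huv h => hg.one_le_of_invariant (n := k * i) (Nat.mul_pos hk hi) huv
      fun x hx => ⟨H^[i] x, h hx, (hHi i x).symm⟩
  obtain ⟨i, hi⟩ := exists_iterate_cover hpq hHc.continuousOn hHm
    (fun u v hu huv hv h => by
      have := hinv 2 (by norm_num) u v huv h
      exact ⟨by linarith, by linarith⟩)
    (fun e he hfix => by
      have hd := hrep e (k * 2) (by omega) (by rw [← hHi, hfix])
      have hdiff : DifferentiableAt ℝ F^[k * 2] e := differentiableAt_of_deriv_ne_zero fun h0 => by
        rw [h0, abs_zero] at hd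
        linarith
      -- Two lifts of the same map differ by a constant, so `H^[2]` inherits the derivative of `F^[k
      -- * 2]`.
      have hconst := eq_of_continuous_of_int
        ((hHc.iterate 2).sub (hFc.continuous.iterate (k * 2))) fun x => by
          obtain ⟨j, hj⟩ := coe_eq_coe_iff_exists_int.1
            ((hHi 2 x).trans (coe_lift_iterate hF (k * 2) x).symm)
          exact ⟨j, by simp only [Pi.sub_apply]; linarith⟩
      have heq : H^[2] = fun x => F^[k * 2] x + (H^[2] e - F^[k * 2] e) := by
        ext x
        have := hconst x e
        simp only [Pi.sub_apply] at this
        linarith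
      refine ⟨_, hd, ?_⟩
      rw [heq]
      exact (hdiff.hasDerivAt.add_const _).hasDerivWithinAt)
    (fun x hx => hcl ▸ subset_closure (hDK hx)) hDo hx₀ hy₀ hxy₀ hDH
  -- Invariance forces length exactly `1`, so an image covering `[p, q]` contains both `p` and `p +
  -- 1`, which `hlong` forbids.
  have hfull := hinv 1 le_rfl p q hpq hHm
  have hp' := hi (left_mem_Icc.2 hpq.le)
  have hq' := hi (right_mem_Icc.2 hpq.le)
  rw [show q = p + 1 by linarith] at hq'
  exact hlong i p hp' hq'

theorem circleRep_eq_fract (hF : ∀ x : ℝ, g (x : UnitAddCircle) = (F x : UnitAddCircle)) (x : ℝ) :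
    circleRep g x = Int.fract (F x) := by
  rw [circleRep, hF]
  have := AddCircle.coe_equivIco_mk_apply (p := (1 : ℝ)) (F x)
  rw [div_one, mul_one] at this
  exact this

/-- Discontinuities of `circleRep` occur only where the lift is an integer. At an accumulation point
of such points `F` would be locally non-injective in value, which a non-zero derivative or
non-flatness rules out. -/
theorem finite_int_preimage (hFc : ContDiff ℝ 2 F)
    (hflat : ∀ c : ℝ, deriv F c = 0 → ∃ l > (0 : ℝ), ∃ K ≥ (1 : ℝ), ∀ᶠ x in 𝓝 c,
      K⁻¹ * |x - c| ^ l ≤ |F x - F c| ∧ |F x - F c| ≤ K * |x - c| ^ l) :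
    {x ∈ Icc (0 : ℝ) 1 | ∃ j : ℤ, F x = j}.Finite := by
  by_contra hinf
  obtain ⟨z, -, hz⟩ := Set.Infinite.exists_accPt_of_subset_isCompact hinf isCompact_Icc
    (fun x hx => hx.1)
  rw [accPt_iff_frequently_nhdsNE] at hz
  refine hz ?_
  have hne : ∀ᶠ x in 𝓝[≠] z, F x ≠ F z := by
    by_cases hd : deriv F z = 0
    · obtain ⟨l, -, K, hK, h⟩ := hflat z hd
      filter_upwards [mem_nhdsWithin_of_mem_nhds h, self_mem_nhdsWithin] with x hx hxz heq
      have h1 : 0 < |x - z| := abs_pos.2 (sub_ne_zero.2 hxz)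
      have h2 : 0 < K⁻¹ * |x - z| ^ l := by positivity
      rw [heq, sub_self, abs_zero] at hx
      linarith [hx.1]
    · exact ((hFc.differentiable two_ne_zero) z).hasDerivAt.eventually_ne hd
  have hclose : ∀ᶠ x in 𝓝[≠] z, |F x - F z| < 1 / 2 := by
    have := Metric.tendsto_nhds.1 (hFc.continuous.tendsto z) (1 / 2) (by norm_num)
    filter_upwards [mem_nhdsWithin_of_mem_nhds this] with x hx
    rwa [← Real.dist_eq]
  by_cases hzi : ∃ j : ℤ, F z = j
  · obtain ⟨j, hj⟩ := hzi
    filter_upwards [hne, hclose] with x hx hx'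
    rintro ⟨-, i, hi⟩
    rw [hi, hj] at hx'
    refine hx ?_
    rw [hi, hj]
    have h1 : |i - j| < 1 := by
      have : ((|i - j| : ℤ) : ℝ) < 1 := by push_cast; linarith
      exact_mod_cast this
    rw [Int.abs_lt_one_iff, sub_eq_zero] at h1
    rw [h1]
  · have hclosed : IsClosed (range ((↑) : ℤ → ℝ)) := Int.isClosedEmbedding_coe_real.isClosed_range
    have : ∀ᶠ x in 𝓝 z, F x ∉ range ((↑) : ℤ → ℝ) :=
      hFc.continuous.tendsto z (hclosed.isOpen_compl.mem_nhds fun ⟨j, hj⟩ => hzi ⟨j, hj.symm⟩)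
    filter_upwards [mem_nhdsWithin_of_mem_nhds this] with x hx
    rintro ⟨-, i, hi⟩
    exact hx ⟨i, hi.symm⟩

theorem IsCircleMapH.isPiecewiseMonotone (hg : IsCircleMapH g) :
    IsPiecewiseMonotone (circleRep g) (Ico 0 1) where
  Ioo_subset := Ioo_subset_Ico_self
  subset_Icc := Ico_subset_Icc_self
  mapsTo := fun x _ => circleRep_mem g x
  finite_exceptional := by
    obtain ⟨F, hFc, hF, hcrit, hflat, -⟩ := hg.smooth
    refine finite_exceptional_of_exists (hcrit.union (finite_int_preimage hFc hflat))
      fun x hx hxZ => ?_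
    simp only [mem_union, not_or] at hxZ
    have hint : ∀ j : ℤ, F x ≠ j := fun j hj => hxZ.2 ⟨Ioo_subset_Icc_self hx, j, hj⟩
    refine exists_isMonotoneInterval (F := F) (c := -⌊F x⌋) hx hFc.contDiffAt
      (fun h => hxZ.1 ⟨Ioo_subset_Ico_self hx, h⟩) ?_
    have hmem : F x ∈ Ioo (⌊F x⌋ : ℝ) (⌊F x⌋ + 1) :=
      ⟨lt_of_le_of_ne (Int.floor_le _) (hint _).symm, Int.lt_floor_add_one _⟩
    filter_upwards [hFc.continuous.continuousAt.eventually (isOpen_Ioo.mem_nhds hmem)] with y hy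
    rw [circleRep_eq_fract hF, Int.fract, Int.floor_eq_iff.2 ⟨hy.1.le, hy.2⟩, sub_eq_add_neg]
  not_invariant := by
    intro n hn p q hp hpq hq h
    have := hg.one_le_of_invariant hn hpq fun x hx =>
      ⟨(circleRep g)^[n] x, h hx, (coe_circleRep_iterate g n x).symm⟩
    linarith
  covers := fun D hD hDo hne _ k hk hDk => hg.exists_covers hD hDo hne hk hDk

theorem IsCircleMapH.continuous (hg : IsCircleMapH g) : Continuous g := by
  obtain ⟨F, hFc, hF, -⟩ := hg.smooth
  refine (QuotientAddGroup.isOpenQuotientMap_mk.continuous_comp_iff).1 ?_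
  have : g ∘ QuotientAddGroup.mk = fun x : ℝ => (F x : UnitAddCircle) := funext hF
  rw [this]
  exact (AddCircle.continuous_mk' 1).comp hFc.continuous

theorem IsCircleMapH.coverEntropy_le (hg : IsCircleMapH g) {c : ℝ}
    (hc : ∀ᶠ n : ℕ in atTop, ((cylinders (circleRep g) n).ncard : ENNReal) ≤ expE (n * c)) :
    Dynamics.coverEntropy g univ ≤ c := by
  refine HofbauerTower.coverEntropy_le (π := fun x : ℝ => (x : UnitAddCircle))
    hg.isPiecewiseMonotone isClosed_univ hg.continuous.continuousOn (mapsTo_univ _ _)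
    (mapsTo_univ _ _) (fun x _ => (coe_circleRep g x).symm) (fun x y => ?_) (fun S hS => ?_) hc
  · rw [dist_eq_norm, ← AddCircle.coe_sub, ← Real.norm_eq_abs]
    exact QuotientAddGroup.norm_mk_le_norm
  · intro y _
    obtain ⟨x, rfl⟩ := QuotientAddGroup.mk_surjective y
    have hx : ((Int.fract x : ℝ) : UnitAddCircle) = (x : UnitAddCircle) :=
      coe_eq_coe_iff_exists_int.2 ⟨-⌊x⌋, by rw [Int.fract]; push_cast; ring⟩
    have h2 := image_closure_subset_closure_image (s := Ioo (0 : ℝ) 1 \ S)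
      (AddCircle.continuous_mk' (1 : ℝ))
    exact h2 ⟨Int.fract x, Icc_subset_closure_diff hS ⟨Int.fract_nonneg x, (Int.fract_lt_one x).le⟩, hx⟩

end circle

/-! ### Both classes of maps together, and the theorem -/

theorem MapH.isPiecewiseMonotone (T : MapH) : IsPiecewiseMonotone T.map T.space := by
  cases T with
  | interval f hf => exact hf.isPiecewiseMonotone
  | circle g hg => exact hg.isPiecewiseMonotone

theorem MapH.htop_le (T : MapH) {c : ℝ}
    (hc : ∀ᶠ n : ℕ in atTop, ((cylinders T.map n).ncard : ENNReal) ≤ expE (n * c)) :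
    T.htop ≤ c := by
  cases T with
  | interval f hf => exact hf.coverEntropy_le hc
  | circle g hg => exact hg.coverEntropy_le hc

end HofbauerTower
end

open HofbauerTower in
theorem mainTheorem8 (T : HofbauerTower.MapH) (φ : ℝ → ℝ)
    (hbddAbove : BddAbove (φ '' T.space)) (hbddBelow : BddBelow (φ '' T.space))
    (hrange : ((sSup (φ '' T.space) - sInf (φ '' T.space) : ℝ) : EReal) < T.htop)
    (hbeta : (fun n : ℕ => HofbauerTower.beta T.map φ n) =o[atTop] (fun n : ℕ => (n : ℝ))) :
    ∃ P : ℝ,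
      Tendsto (fun n : ℕ => ENNReal.log (HofbauerTower.topSum T.map φ n) / n) atTop
        (𝓝 (P : EReal)) ∧
      ∀ E : Set (Set ℝ), HofbauerTower.IsTransitivePart T.map E →
        ∀ k : ℕ, ∀ Chat ∈ HofbauerTower.hatCylinders T.map E k,
          Tendsto (fun n : ℕ => ENNReal.log (HofbauerTower.hatTopSum T.map φ Chat n) / n) atTop
            (𝓝 (P : EReal)) ∧
          HofbauerTower.hatGurevich T.map φ Chat = (P : EReal) := by
  have hf := T.isPiecewiseMonotone
  set a := sInf (φ '' T.space) with ha'
  set b := sSup (φ '' T.space) with hb'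
  have ha : ∀ x ∈ T.space, a ≤ φ x := fun x hx => csInf_le hbddBelow ⟨x, hx, rfl⟩
  have hb : ∀ x ∈ T.space, φ x ≤ b := fun x hx => le_csSup hbddAbove ⟨x, hx, rfl⟩
  obtain ⟨P, hP₁, hP₂⟩ := exists_pressure hf ha hb
  -- If `P ≤ b`, the number of `n`-cylinders is eventually at most `exp(nc)` for some `c` between `b
  -- - a` and the entropy, contradicting `MapH.htop_le`.
  have hbP : b < P := by
    by_contra! hPb
    obtain ⟨c, hc, hc'⟩ := EReal.lt_iff_exists_real_btwn.1 hrange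
    have hc1 : b - a < c := EReal.coe_lt_coe_iff.1 hc
    refine hc'.not_ge (T.htop_le ?_)
    filter_upwards [hP₂ (c + a - b) (by linarith)] with n hn
    have h1 := (le_topSum hf ha n).trans hn
    have h2 : expE (n * (P + (c + a - b))) ≤ expE (n * c) * expE (n * a) := by
      rw [← expE_add]
      refine expE_mono ?_
      rw [← mul_add]
      exact mul_le_mul_of_nonneg_left (by linarith) (Nat.cast_nonneg n)
    exact (ENNReal.mul_le_mul_iff_left (expE_ne_zero _) (expE_ne_top _)).1 (h1.trans h2)
  exact ⟨P, tendsto_log_div hP₁ hP₂, fun E hE k Chat hChat =>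
    hat_pressures hf ha hb hbeta hP₁ hP₂ hbP hE hChat⟩
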